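/- Let $z_1,z_2$ be independent variables, $K=\mathbb{Q}(z_1,z_2)$, and let $\hbar^{1/2}$ be a formal variable. For $m\ge 0$ let $\mathrm{Li}_{-m}(z)=\left(z\frac{d}{dz}\right)^m\frac{z}{1-z}\in\mathbb{Q}(z)$, and let $B_k$ be the Bernoulli numbers, with $B_1=-\tfrac12$. For a $K$-algebra $A$, $x\in A$ and $z\in K$ with $z\neq 1$, put $$\psi_\hbar(x,z)=\exp\Big(-\sum_{\substack{k,\ell\ge 0\\ k+\ell/2>1}}\frac{B_k\,x^\ell\,\hbar^{k+\frac{\ell}{2}-1}}{\ell!\,k!}\,\mathrm{Li}_{2-k-\ell}(z)\Big)\in A[[\hbar^{1/2}]].$$ For $\lambda\in K\setminus\{0\}$, let $\langle\,\cdot\,\rangle_{w,\lambda}: K[x,y][w][[\hbar^{1/2}]]\to K[x,y][[\hbar^{1/2}]]$ be the formal Gaussian integral, which is applied to each coefficient in $\hbar^{1/2}$, is $K[x,y]$-linear there, and satisfies $\langle w^n\rangle_{w,\lambda}=\lambda^{-n/2}(n-1)!!$ for $n$ even (with $(-1)!!=1$) and $\langle w^n\rangle_{w,\lambda}=0$ for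 $n$ odd. Put $z_0=z_1+z_2-z_1z_2$ and $$\delta=2+\mathrm{Li}_0(z_1z_0^{-1})+\mathrm{Li}_0(z_0)+\mathrm{Li}_0(z_2z_0^{-1})=\frac{(z_1+z_2-z_1z_2)^2}{z_1z_2(1-z_1)(1-z_2)}.$$ **Theorem 3.6.** In the ring $\mathbb{Q}(z_1,z_2)[x,y][[\hbar^{1/2}]]$, $$\psi_\hbar(x,z_1)\,\psi_\hbar(y,z_2)=e^{-\frac{\hbar}{24}}\Big\langle\psi_\hbar\Big(-w-y+\tfrac{xz_2+yz_1}{z_0},\,\tfrac{z_1}{z_0}\Big)\,\psi_\hbar\Big(w+x+y-\tfrac{xz_2+yz_1}{z_0},\,z_0\Big)\,\psi_\hbar\Big(-w-x+\tfrac{xz_2+yz_1}{z_0},\,\tfrac{z_2}{z_0}\Big)\Big\rangle_{w,\delta}.$$ -/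

import Mathlib

open scoped Nat

noncomputable section

namespace FormalPentagon

/-- The numerators of the polylogarithms of nonpositive order: `Li_{-m}(z) = N_m(z) / (1 - z)^(m+1)`,
with `N_0 = z` and, by the quotient rule applied to `z d/dz`,
`N_{m+1} = z (1 - z) N_m' + (m + 1) z N_m`. -/
def polylogNum : ℕ → Polynomial ℚ
  | 0 => Polynomial.X
  | m + 1 => Polynomial.X * (1 - Polynomial.X) * Polynomial.derivative (polylogNum m)
      + ((m : Polynomial ℚ) + 1) * Polynomial.X * polylogNum m

/-- `polylogNeg m z` is `Li_{-m}(z)`, the rational function determined by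
`Li_0(z) = z / (1 - z)` and `z d/dz Li_{-m} = Li_{-m-1}`. -/
def polylogNeg {K : Type*} [Field K] [Algebra ℚ K] (m : ℕ) (z : K) : K :=
  Polynomial.aeval z (polylogNum m) / (1 - z) ^ (m + 1)

/-- The defining differential equation `z d/dz Li_{-m}(z) = Li_{-m-1}(z)`. -/
theorem polylogNeg_hasDerivAt (m : ℕ) {z : ℝ} (hz0 : z ≠ 0) (hz : z ≠ 1) :
    HasDerivAt (polylogNeg (K := ℝ) m) (polylogNeg (m + 1) z / z) z := by
  have h1 : (1 - z) ≠ 0 := sub_ne_zero.mpr (Ne.symm hz)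
  have hN := (polylogNum m).hasDerivAt_aeval z
  have hD : HasDerivAt (fun w : ℝ => (1 - w) ^ (m + 1))
      (((m + 1 : ℕ) : ℝ) * (1 - z) ^ m * (-1)) z := by
    exact ((hasDerivAt_id z).const_sub 1).pow (m + 1)
  have h := hN.div hD (pow_ne_zero _ h1)
  refine h.congr_deriv ?_
  simp only [polylogNeg, polylogNum, map_add, map_mul, map_sub, map_one, map_natCast,
    Polynomial.aeval_X]
  push_cast
  field_simp
  ring

/-- The exponential of a formal power series (meaningful when the constant term is zero). -/
def formalExp {A : Type*} [CommRing A] [Algebra ℚ A] (f : PowerSeries A) : PowerSeries A :=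
  (PowerSeries.exp ℚ).subst f

/-- The exponent of `ψ_ħ(x, z)`, as a power series in `t = ħ^(1/2)` over a `K`-algebra `A`
that contains `x`: for `n ≥ 1` the coefficient of `t^n = ħ^(k + ℓ/2 - 1)` collects the pairs
`(k, ℓ)` with `2k + ℓ = n + 2`; for these `2 - k - ℓ = -(k + ℓ - 2) ≤ 0`. Mathlib's `bernoulli` is
normalized by `B_1 = -1/2`. -/
def psiExponent {K A : Type*} [Field K] [Algebra ℚ K] [CommRing A] [Algebra ℚ A] [Algebra K A]
    (x : A) (z : K) : PowerSeries A :=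
  PowerSeries.mk fun n =>
    if n = 0 then 0 else
      -∑ p ∈ (Finset.range (n + 3) ×ˢ Finset.range (n + 3)) with 2 * p.1 + p.2 = n + 2,
        algebraMap ℚ A (bernoulli p.1 / ((p.2 ! : ℚ) * (p.1 ! : ℚ))) * x ^ p.2 *
          algebraMap K A (polylogNeg (p.1 + p.2 - 2) z)

/-- The formal power series `ψ_ħ(x, z)` in `t = ħ^(1/2)`. -/
def psi {K A : Type*} [Field K] [Algebra ℚ K] [CommRing A] [Algebra ℚ A] [Algebra K A]
    (x : A) (z : K) : PowerSeries A :=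
  formalExp (psiExponent x z)

/-- The formal Gaussian integral of the monomial `w^n` with respect to the quadratic form `lam`:
`lam^(-n/2) (n-1)!!` for even `n` (with `(-1)!! = 1`) and `0` for odd `n`. -/
def gaussMoment {K : Type*} [Field K] (lam : K) (n : ℕ) : K :=
  if Even n then lam⁻¹ ^ (n / 2) * (((n - 1)‼ : ℕ) : K) else 0

/-- The formal Gaussian integral `⟨f⟩_{w, lam}` in the variable `w = Polynomial.X`, for `f` a power
series in `t = ħ^(1/2)` with coefficients in `A[w]`: extended from monomials `A`-linearly and
coefficient by coefficient in `t`. -/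
def formalGauss {K A : Type*} [Field K] [CommRing A] [Algebra K A]
    (lam : K) (f : PowerSeries (Polynomial A)) : PowerSeries A :=
  PowerSeries.mk fun n =>
    (PowerSeries.coeff n f).sum fun j a => a * algebraMap K A (gaussMoment lam j)

/-- The field `ℚ(z₁, z₂)` of rational functions in two variables. -/
abbrev ShapeField : Type := FractionRing (MvPolynomial (Fin 2) ℚ)

/-- The polynomial ring `ℚ(z₁, z₂)[x, y]`. -/
abbrev ArgRing : Type := MvPolynomial (Fin 2) ShapeField

/-- The variable `z₁`. -/
def z₁ : ShapeField := algebraMap (MvPolynomial (Fin 2) ℚ) ShapeField (MvPolynomial.X 0)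

/-- The variable `z₂`. -/
def z₂ : ShapeField := algebraMap (MvPolynomial (Fin 2) ℚ) ShapeField (MvPolynomial.X 1)

/-- `z₀ = z₁ + z₂ - z₁ z₂`. -/
def z₀ : ShapeField := z₁ + z₂ - z₁ * z₂

/-- `δ = 2 + Li₀(z₁/z₀) + Li₀(z₀) + Li₀(z₂/z₀)`. -/
def pentagonForm : ShapeField :=
  2 + polylogNeg 0 (z₁ / z₀) + polylogNeg 0 z₀ + polylogNeg 0 (z₂ / z₀)

/-- A polynomial in `z₁, z₂` with a nonzero value is nonzero in `ℚ(z₁, z₂)`. -/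
theorem algebraMap_ne_zero_of_eval (p : MvPolynomial (Fin 2) ℚ) (v : Fin 2 → ℚ)
    (h : MvPolynomial.eval v p ≠ 0) :
    algebraMap (MvPolynomial (Fin 2) ℚ) ShapeField p ≠ 0 := by
  intro h0
  have h1 := (IsFractionRing.to_map_eq_zero_iff (K := ShapeField)).mp h0
  exact h (by rw [h1, map_zero])

/-- The closed form `δ = (z₁ + z₂ - z₁ z₂)² / (z₁ z₂ (1 - z₁) (1 - z₂))`. -/
theorem pentagonForm_eq : pentagonForm = z₀ ^ 2 / (z₁ * z₂ * (1 - z₁) * (1 - z₂)) := by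
  have h1 : z₁ ≠ 0 := algebraMap_ne_zero_of_eval _ (fun _ => 3) (by simp)
  have h2 : z₂ ≠ 0 := algebraMap_ne_zero_of_eval _ (fun _ => 3) (by simp)
  have h3 : 1 - z₁ ≠ 0 := by
    have := algebraMap_ne_zero_of_eval (1 - MvPolynomial.X 0) (fun _ => 3) (by norm_num)
    simpa [z₁] using this
  have h4 : 1 - z₂ ≠ 0 := by
    have := algebraMap_ne_zero_of_eval (1 - MvPolynomial.X 1) (fun _ => 3) (by norm_num)
    simpa [z₂] using this
  have h0 : z₁ + z₂ - z₁ * z₂ ≠ 0 := by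
    have := algebraMap_ne_zero_of_eval
      (MvPolynomial.X 0 + MvPolynomial.X 1 - MvPolynomial.X 0 * MvPolynomial.X 1)
      (fun _ => 3) (by norm_num)
    simpa [z₁, z₂] using this
  have hz : z₀ ≠ 0 := h0
  have e0 : 1 - z₀ = (1 - z₁) * (1 - z₂) := by simp only [z₀]; ring
  have e1 : 1 - z₁ / z₀ = z₂ * (1 - z₁) / z₀ := by
    rw [eq_div_iff hz, sub_mul, div_mul_cancel₀ _ hz]; simp only [z₀]; ring
  have e2 : 1 - z₂ / z₀ = z₁ * (1 - z₂) / z₀ := by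
    rw [eq_div_iff hz, sub_mul, div_mul_cancel₀ _ hz]; simp only [z₀]; ring
  simp only [pentagonForm, polylogNeg, polylogNum, Polynomial.aeval_X, zero_add, pow_one,
    e0, e1, e2]
  simp only [z₀]
  field_simp
  ring

/-- The variable `x`. -/
def varX : ArgRing := MvPolynomial.X 0

/-- The variable `y`. -/
def varY : ArgRing := MvPolynomial.X 1

/-- The linear form `(x z₂ + y z₁) / z₀`. -/
def shift : ArgRing :=
  MvPolynomial.C (z₂ / z₀) * varX + MvPolynomial.C (z₁ / z₀) * varY

/-- The factor `e^{-ħ/24}`, where `ħ = t^2`. -/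
def expFactor : PowerSeries ArgRing :=
  formalExp (PowerSeries.C (algebraMap ℚ ArgRing (-1 / 24)) * PowerSeries.X ^ 2)

end FormalPentagon

end

/-! Write t for ħ^(1/2), u = 1/z₁ and v = 1/z₂. Every Li_{-m} is a polynomial in Li₀, so both sides
make sense over any ℚ-algebra in which 1 - u, 1 - v and 1 - u - v are invertible (`PentagonData`).
In these coordinates everything is regular at u = v = 0, that is, at z₁ = z₂ = ∞. Both sides are
shown to obey the same two equations, and are then compared at that point.

The first is a difference equation: the substitution (x, y) → (x + t, y + t), realized as `flow d` =
exp(t d) with d = ∂x + ∂y, multiplies both sides by the same series (`flow_lhs`, `flow_rhs`). Its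
source is `flow_psiP`: the shift x → x + t multiplies ψ by (1 - z e^{xt})/(1 - z) and the
exponential of a quadratic polynomial in t. Under the integral sign w is translated along, so that
only the factor of shape z₀ changes. The resulting integral is evaluated by `gauss_shiftFactor`,
from a rational identity modulo a combination that integrates to zero (`gauss_telescope`).

The second is differential: with D = z₁∂₁ + z₂∂₂, both sides solve t·DF = dF + t·`eulerTerm`·F
(`euler_lhs`, `euler_rhs`). Its source is `psiDx_eq`, which relates ∂x and z∂z on the exponent of ψ.

Hence the ratio g of the two sides is invariant under the shift, which forces dg = 0, and then t·Dg
= 0 (`exists_ratio`). Over power series in u and v this makes g constant in u and v. At u = v = 0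
every ψ is 1 or the exponential of a quadratic, the integral is explicit, and g = 1
(`rhs_eq_lhs_of_eq_zero`). The universal case embeds into power series in u and v, and every other
case is a specialization of it (`rhs_eq_lhs`). -/

noncomputable section

namespace FormalPentagon

open PowerSeries

/-! ### Formal differential equations, exponentials and flows exp(t d) over A⟦t⟧. -/

section Calculus

variable {A B : Type*} [CommRing A] [Algebra ℚ A] [CommRing B] [Algebra ℚ B]

theorem ext_of_derivative {f g : PowerSeries A} (h0 : constantCoeff f = constantCoeff g)
    (h1 : derivative A f = derivative A g) : f = g :=
  haveI : IsAddTorsionFree A := .of_module_rat A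
  derivative.ext h1 h0

theorem cast_succ_mul_cancel {n : ℕ} {a b : A} (h : a * ((n : A) + 1) = b * ((n : A) + 1)) :
    a = b := by
  have e : algebraMap ℚ A (1 / ((n : ℚ) + 1)) * ((n : A) + 1) = 1 := by
    have h1 : ((n : A) + 1) = algebraMap ℚ A ((n : ℚ) + 1) := by simp
    rw [h1, ← map_mul, one_div_mul_cancel (by positivity), map_one]
  calc a = a * ((n : A) + 1) * algebraMap ℚ A (1 / ((n : ℚ) + 1)) := by
        rw [mul_assoc, mul_comm ((n : A) + 1), e, mul_one]
    _ = b := by rw [h, mul_assoc, mul_comm ((n : A) + 1), e, mul_one]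

/-- A linear homogeneous differential equation has only the trivial solution with zero
initial value. -/
theorem eq_zero_of_derivative_eq_mul {f h : PowerSeries A} (h0 : constantCoeff f = 0)
    (h1 : derivative A f = h * f) : f = 0 := by
  ext n
  rw [map_zero]
  induction n using Nat.strong_induction_on with
  | _ n ih =>
    rcases n with _ | n
    · simpa using h0
    · apply cast_succ_mul_cancel (n := n)
      rw [← coeff_derivative, h1, coeff_mul, zero_mul]
      refine Finset.sum_eq_zero fun p hp => ?_
      rw [ih p.2 (by have := Finset.HasAntidiagonal.mem_antidiagonal.mp hp; omega), mul_zero]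

theorem eq_of_derivative_eq_mul {f g h : PowerSeries A}
    (h0 : constantCoeff f = constantCoeff g)
    (hf : derivative A f = h * f) (hg : derivative A g = h * g) : f = g := by
  refine sub_eq_zero.mp (eq_zero_of_derivative_eq_mul (h := h) ?_ ?_)
  · rw [map_sub, h0, sub_self]
  · rw [map_sub, hf, hg, mul_sub]

/-- Two maps into power series which intertwine the derivative with the same operator and
agree in the constant coefficient are equal. -/
theorem eq_of_derivative_comp {T : Type*} (S : T → T) {U V : T → PowerSeries A}
    (h0 : ∀ f, constantCoeff (U f) = constantCoeff (V f))
    (hU : ∀ f, derivative A (U f) = U (S f)) (hV : ∀ f, derivative A (V f) = V (S f)) (f : T) :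
    U f = V f := by
  ext n
  induction n generalizing f with
  | zero => simpa using h0 f
  | succ n ih =>
    apply cast_succ_mul_cancel (n := n)
    rw [← coeff_derivative, ← coeff_derivative, hU, hV, ih]

/-! ### The formal exponential -/

theorem formalExp_eq (f : PowerSeries A) (hf : constantCoeff f = 0) :
    formalExp f = (exp A).subst f := by
  have hs := HasSubst.of_constantCoeff_zero' hf
  ext n
  rw [formalExp, coeff_subst' hs, coeff_subst' hs]
  refine finsum_congr fun d => ?_
  rw [coeff_exp, coeff_exp, smul_eq_mul, Algebra.smul_def]
  rfl

theorem constantCoeff_formalExp {f : PowerSeries A} (hf : constantCoeff f = 0) :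
    constantCoeff (formalExp f) = 1 := by
  have hs := HasSubst.of_constantCoeff_zero' hf
  rw [formalExp_eq f hf, ← coeff_zero_eq_constantCoeff_apply, coeff_subst' hs,
    finsum_eq_single _ 0]
  · simp
  · intro d hd
    simp [hf, hd]

theorem derivative_formalExp {f : PowerSeries A} (hf : constantCoeff f = 0) :
    derivative A (formalExp f) = derivative A f * formalExp f := by
  rw [formalExp_eq f hf, derivative_subst (HasSubst.of_constantCoeff_zero' hf), derivative_exp,
    mul_comm]

theorem formalExp_unique {f E : PowerSeries A} (hf : constantCoeff f = 0)
    (h0 : constantCoeff E = 1) (h1 : derivative A E = derivative A f * E) : E = formalExp f :=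
  eq_of_derivative_eq_mul (by rw [h0, constantCoeff_formalExp hf]) h1 (derivative_formalExp hf)

@[simp]
theorem formalExp_zero : formalExp (0 : PowerSeries A) = 1 :=
  (formalExp_unique (map_zero _) (map_one _) (by simp)).symm

theorem formalExp_add {f g : PowerSeries A} (hf : constantCoeff f = 0)
    (hg : constantCoeff g = 0) : formalExp (f + g) = formalExp f * formalExp g := by
  refine (formalExp_unique (by simp [hf, hg]) ?_ ?_).symm
  · rw [map_mul, constantCoeff_formalExp hf, constantCoeff_formalExp hg, one_mul]
  · rw [Derivation.leibniz, derivative_formalExp hf, derivative_formalExp hg, map_add,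
      smul_eq_mul, smul_eq_mul]
    ring

theorem formalExp_mul_neg {f : PowerSeries A} (hf : constantCoeff f = 0) :
    formalExp f * formalExp (-f) = 1 := by
  rw [← formalExp_add hf (by simp [hf]), add_neg_cancel, formalExp_zero]

omit [Algebra ℚ A] [Algebra ℚ B] in
theorem constantCoeff_map_apply (r : A →+* B) (f : PowerSeries A) :
    constantCoeff (map r f) = r (constantCoeff f) := by
  rw [← coeff_zero_eq_constantCoeff_apply, coeff_map, coeff_zero_eq_constantCoeff_apply]

omit [Algebra ℚ A] [Algebra ℚ B] in
theorem derivative_map (r : A →+* B) (f : PowerSeries A) :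
    derivative B (map r f) = map r (derivative A f) := by
  ext n
  simp [coeff_derivative]

theorem map_formalExp (r : A →+* B) {f : PowerSeries A} (hf : constantCoeff f = 0) :
    map r (formalExp f) = formalExp (map r f) := by
  refine formalExp_unique (by rw [constantCoeff_map_apply, hf, map_zero]) ?_ ?_
  · rw [constantCoeff_map_apply, constantCoeff_formalExp hf, map_one]
  · rw [derivative_map, derivative_map, derivative_formalExp hf, map_mul]

/-! ### Coefficientwise derivations -/

/-- The derivation of a power series ring given by a derivation of the coefficients. -/
def mvCoeffDer {σ : Type*} (d : Derivation ℚ A A) :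
    Derivation ℚ (MvPowerSeries σ A) (MvPowerSeries σ A) :=
  Derivation.mk'
    { toFun := fun f m => d (MvPowerSeries.coeff m f)
      map_add' := fun f g => by
        funext m
        simp only [map_add]
        rfl
      map_smul' := fun c f => by
        funext m
        exact d.map_smul c (MvPowerSeries.coeff m f) }
    fun f g => by
      classical
      ext m
      change d (MvPowerSeries.coeff m (f * g)) = _
      rw [map_add, smul_eq_mul, smul_eq_mul, mul_comm g, MvPowerSeries.coeff_mul,
        MvPowerSeries.coeff_mul, MvPowerSeries.coeff_mul, map_sum, ← Finset.sum_add_distrib]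
      refine Finset.sum_congr rfl fun p _ => ?_
      rw [Derivation.leibniz, smul_eq_mul, smul_eq_mul, mul_comm (MvPowerSeries.coeff p.2 g)]
      rfl

theorem coeff_mvCoeffDer {σ : Type*} (d : Derivation ℚ A A) (f : MvPowerSeries σ A) (m : σ →₀ ℕ) :
    MvPowerSeries.coeff m (mvCoeffDer d f) = d (MvPowerSeries.coeff m f) := rfl

/-- The derivation of `A⟦t⟧` that applies a derivation of `A` to each coefficient. -/
def coeffDer (d : Derivation ℚ A A) : Derivation ℚ (PowerSeries A) (PowerSeries A) :=
  mvCoeffDer d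

@[simp]
theorem coeff_coeffDer (d : Derivation ℚ A A) (f : PowerSeries A) (n : ℕ) :
    coeff n (coeffDer d f) = d (coeff n f) := rfl

@[simp]
theorem constantCoeff_coeffDer (d : Derivation ℚ A A) (f : PowerSeries A) :
    constantCoeff (coeffDer d f) = d (constantCoeff f) := rfl

@[simp]
theorem coeffDer_C (d : Derivation ℚ A A) (a : A) : coeffDer d (C a) = C (d a) := by
  ext n
  rw [coeff_coeffDer, coeff_C, coeff_C]
  split_ifs <;> simp

@[simp]
theorem coeffDer_X (d : Derivation ℚ A A) : coeffDer d (X : PowerSeries A) = 0 := by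
  ext n
  rw [coeff_coeffDer, coeff_X]
  split_ifs <;> simp

theorem coeffDer_mul (d : Derivation ℚ A A) (f g : PowerSeries A) :
    coeffDer d (f * g) = f * coeffDer d g + g * coeffDer d f := by
  rw [Derivation.leibniz, smul_eq_mul, smul_eq_mul]

omit [Algebra ℚ A] in
theorem derivative_mul (f g : PowerSeries A) :
    derivative A (f * g) = f * derivative A g + g * derivative A f := by
  rw [Derivation.leibniz, smul_eq_mul, smul_eq_mul]

theorem derivative_coeffDer (d : Derivation ℚ A A) (f : PowerSeries A) :
    derivative A (coeffDer d f) = coeffDer d (derivative A f) := by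
  ext n
  rw [coeff_derivative, coeff_coeffDer, coeff_coeffDer, coeff_derivative, Derivation.leibniz]
  simp [mul_comm]

theorem coeffDer_formalExp (d : Derivation ℚ A A) {f : PowerSeries A}
    (hf : constantCoeff f = 0) :
    coeffDer d (formalExp f) = coeffDer d f * formalExp f := by
  refine sub_eq_zero.mp (eq_zero_of_derivative_eq_mul (h := derivative A f) ?_ ?_)
  · rw [map_sub, map_mul, constantCoeff_coeffDer, constantCoeff_coeffDer,
      constantCoeff_formalExp hf, hf]
    simp
  · rw [map_sub, derivative_mul, derivative_coeffDer, derivative_coeffDer,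
      derivative_formalExp hf, coeffDer_mul]
    ring

/-! ### The flow of a derivation -/

/-- The coefficients of `exp (t d) f`. -/
def flowCoeff (d : Derivation ℚ A A) : ℕ → PowerSeries A → A
  | 0, f => constantCoeff f
  | n + 1, f =>
    flowCoeff d n (derivative A f + coeffDer d f) * algebraMap ℚ A (1 / ((n : ℚ) + 1))

/-- The operator `exp (t d)` on `A⟦t⟧`. -/
def flowFun (d : Derivation ℚ A A) (f : PowerSeries A) : PowerSeries A :=
  PowerSeries.mk fun n => flowCoeff d n f

theorem constantCoeff_flowFun (d : Derivation ℚ A A) (f : PowerSeries A) :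
    constantCoeff (flowFun d f) = constantCoeff f := by
  rw [← coeff_zero_eq_constantCoeff_apply, flowFun, coeff_mk, flowCoeff]

theorem derivative_flowFun (d : Derivation ℚ A A) (f : PowerSeries A) :
    derivative A (flowFun d f) = flowFun d (derivative A f + coeffDer d f) := by
  ext n
  rw [coeff_derivative, flowFun, flowFun, coeff_mk, coeff_mk, flowCoeff, mul_assoc]
  have h1 : ((n : A) + 1) = algebraMap ℚ A ((n : ℚ) + 1) := by simp
  rw [h1, ← map_mul, one_div_mul_cancel (by positivity), map_one, mul_one]

theorem flowFun_add (d : Derivation ℚ A A) (f g : PowerSeries A) :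
    flowFun d (f + g) = flowFun d f + flowFun d g := by
  refine eq_of_derivative_comp (T := PowerSeries A × PowerSeries A)
    (fun p => (derivative A p.1 + coeffDer d p.1, derivative A p.2 + coeffDer d p.2))
    (U := fun p => flowFun d (p.1 + p.2)) (V := fun p => flowFun d p.1 + flowFun d p.2)
    ?_ ?_ ?_ (f, g)
  · intro p
    simp only [map_add, constantCoeff_flowFun]
  · intro p
    rw [derivative_flowFun, map_add, map_add]
    congr 1
    ring
  · intro p
    rw [map_add, derivative_flowFun, derivative_flowFun]

/-- The generator d/dt + d is itself a derivation, so its exponential is multiplicative; the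
induction compares one coefficient at a time. -/
theorem flowFun_mul (d : Derivation ℚ A A) (f g : PowerSeries A) :
    flowFun d (f * g) = flowFun d f * flowFun d g := by
  ext n
  induction n generalizing f g with
  | zero => simp [constantCoeff_flowFun]
  | succ n ih =>
    apply cast_succ_mul_cancel (n := n)
    rw [← coeff_derivative, ← coeff_derivative, derivative_mul, derivative_flowFun,
      derivative_flowFun, derivative_flowFun, derivative_mul, coeffDer_mul, map_add,
      mul_comm (flowFun d g), ← ih, ← ih, ← map_add, ← flowFun_add]
    congr 2
    ring

theorem flowFun_eq_self (d : Derivation ℚ A A) {f : PowerSeries A} (hf : coeffDer d f = 0) :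
    flowFun d f = f := by
  refine eq_of_derivative_comp (T := {f : PowerSeries A // coeffDer d f = 0})
    (fun f => ⟨derivative A f.1, by rw [← derivative_coeffDer, f.2, map_zero]⟩)
    (U := fun f => flowFun d f.1) (V := fun f => f.1) ?_ ?_ (fun _ => rfl) ⟨f, hf⟩
  · intro f
    exact constantCoeff_flowFun d f.1
  · intro f
    exact (derivative_flowFun d f.1).trans (congrArg (flowFun d)
      ((congrArg (derivative A f.1 + ·) f.2).trans (add_zero _)))

/-- The ring endomorphism `exp (t d)` of `A⟦t⟧`. -/
def flow (d : Derivation ℚ A A) : PowerSeries A →+* PowerSeries A where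
  toFun := flowFun d
  map_zero' := flowFun_eq_self d (map_zero _)
  map_one' := flowFun_eq_self d (coeffDer d).map_one_eq_zero
  map_add' := flowFun_add d
  map_mul' := flowFun_mul d

@[simp]
theorem constantCoeff_flow (d : Derivation ℚ A A) (f : PowerSeries A) :
    constantCoeff (flow d f) = constantCoeff f := constantCoeff_flowFun d f

theorem derivative_flow (d : Derivation ℚ A A) (f : PowerSeries A) :
    derivative A (flow d f) = flow d (derivative A f + coeffDer d f) := derivative_flowFun d f

theorem flow_eq_self (d : Derivation ℚ A A) {f : PowerSeries A} (hf : coeffDer d f = 0) :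
    flow d f = f := flowFun_eq_self d hf

@[simp]
theorem flow_X (d : Derivation ℚ A A) : flow d (X : PowerSeries A) = X :=
  flow_eq_self d (coeffDer_X d)

theorem flow_C_of_eq_zero (d : Derivation ℚ A A) {a : A} (ha : d a = 0) : flow d (C a) = C a :=
  flow_eq_self d (by rw [coeffDer_C, ha, map_zero])

theorem flow_C (d : Derivation ℚ A A) {a : A} (ha : d (d a) = 0) :
    flow d (C a) = C a + C (d a) * X := by
  refine ext_of_derivative (by simp) ?_
  rw [derivative_flow, derivative_C, coeffDer_C, zero_add, flow_C_of_eq_zero d ha, map_add,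
    derivative_C, derivative_mul, derivative_C, derivative_X]
  ring

theorem flow_formalExp (d : Derivation ℚ A A) {f : PowerSeries A} (hf : constantCoeff f = 0) :
    flow d (formalExp f) = formalExp (flow d f) := by
  refine formalExp_unique (by simpa using hf) ?_ ?_
  · rw [constantCoeff_flow, constantCoeff_formalExp hf]
  · rw [derivative_flow, derivative_flow, derivative_formalExp hf, coeffDer_formalExp d hf,
      ← add_mul, map_mul]

/-- Flows of commuting derivations compose to the flow of the sum. -/
theorem flow_add_apply (d e : Derivation ℚ A A) (h : ∀ a, d (e a) = e (d a))
    (f : PowerSeries A) : flow (d + e) f = flow d (flow e f) := by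
  have hc : ∀ f, coeffDer d (flow e f) = flow e (coeffDer d f) := fun f => by
    refine eq_of_derivative_comp (fun f => derivative A f + coeffDer e f)
      (U := fun f => coeffDer d (flow e f)) (V := fun f => flow e (coeffDer d f)) ?_ ?_ ?_ f
    · intro f
      simp
    · intro f
      rw [derivative_coeffDer, derivative_flow]
    · intro f
      rw [derivative_flow, map_add (coeffDer d), derivative_coeffDer]
      congr 2
      ext n
      simp [h]
  refine eq_of_derivative_comp (fun f => derivative A f + coeffDer (d + e) f)
      (U := fun f => flow (d + e) f) (V := fun f => flow d (flow e f)) ?_ ?_ ?_ f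
  · intro f
    simp
  · intro f
    rw [derivative_flow]
  · intro f
    rw [derivative_flow, derivative_flow, hc, ← map_add (flow e)]
    congr 2
    ext n
    simp only [map_add, coeff_coeffDer, Derivation.add_apply]
    ring

theorem coeff_flow (d : Derivation ℚ A A) (f : PowerSeries A) (n : ℕ) :
    coeff n (flow d f) = ∑ p ∈ Finset.HasAntidiagonal.antidiagonal n,
      algebraMap ℚ A (1 / (p.2 ! : ℚ)) * d^[p.2] (coeff p.1 f) := by
  revert n
  suffices h : flow d f = PowerSeries.mk fun n => ∑ p ∈ Finset.HasAntidiagonal.antidiagonal n,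
      algebraMap ℚ A (1 / (p.2 ! : ℚ)) * d^[p.2] (coeff p.1 f) by
    intro n
    rw [h, coeff_mk]
  refine eq_of_derivative_comp (fun f => derivative A f + coeffDer d f) (U := fun f => flow d f)
    (V := fun f => PowerSeries.mk fun n => ∑ p ∈ Finset.HasAntidiagonal.antidiagonal n,
      algebraMap ℚ A (1 / (p.2 ! : ℚ)) * d^[p.2] (coeff p.1 f)) ?_ (derivative_flow d) ?_ f
  · intro f
    rw [constantCoeff_flow, ← coeff_zero_eq_constantCoeff_apply,
      ← coeff_zero_eq_constantCoeff_apply, coeff_mk]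
    simp
  · intro f
    have hit : ∀ j : ℕ, ∀ a b : A, d^[j] (a + b) = d^[j] a + d^[j] b := fun j a b =>
      iterate_map_add d j a b
    have hmul : ∀ j : ℕ, ∀ (a : A) (m : ℕ), d^[j] (a * ((m : A) + 1)) = d^[j] a * ((m : A) + 1) := by
      intro j a m
      induction j with
      | zero => rfl
      | succ j ih =>
        rw [Function.iterate_succ_apply', ih, Function.iterate_succ_apply', Derivation.leibniz]
        simp [mul_comm]
    ext n
    rw [coeff_derivative, coeff_mk, coeff_mk, Finset.sum_mul]
    -- Splitting n + 1 as p.1 + p.2 separates the contribution of d/dt from that of d.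
    have e : ∀ p ∈ Finset.HasAntidiagonal.antidiagonal (n + 1),
        algebraMap ℚ A (1 / (p.2 ! : ℚ)) * d^[p.2] (coeff p.1 f) * ((n : A) + 1) =
        algebraMap ℚ A (1 / (p.2 ! : ℚ)) * d^[p.2] (coeff p.1 f) * (p.1 : A) +
        algebraMap ℚ A (1 / (p.2 ! : ℚ)) * d^[p.2] (coeff p.1 f) * (p.2 : A) := fun p hp => by
      have hp' := Finset.HasAntidiagonal.mem_antidiagonal.mp hp
      rw [← mul_add]
      congr 1
      exact_mod_cast congrArg (Nat.cast (R := A)) hp'.symm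
    rw [Finset.sum_congr rfl e, Finset.sum_add_distrib, Finset.Nat.sum_antidiagonal_succ,
      Finset.Nat.sum_antidiagonal_succ']
    simp only [map_add, coeff_coeffDer, coeff_derivative, hit, hmul,
      ← Function.iterate_succ_apply, Nat.cast_zero, mul_zero, zero_add, Nat.cast_succ]
    rw [← Finset.sum_add_distrib]
    refine Finset.sum_congr rfl fun p _ => ?_
    rw [mul_add]
    have h1 : algebraMap ℚ A (1 / (p.2 ! : ℚ)) =
        algebraMap ℚ A (1 / ((p.2 + 1)! : ℚ)) * ((p.2 : A) + 1) := by
      rw [show ((p.2 : A) + 1) = algebraMap ℚ A ((p.2 : ℚ) + 1) by simp, ← map_mul]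
      congr 1
      rw [Nat.factorial_succ]
      push_cast
      field_simp
    rw [h1]
    ring

/-- In degree n + 1, Taylor's formula has the terms f_{n+1}, d f_n and higher iterates of d on
earlier coefficients. The last vanish by induction, so invariance leaves d f_n = 0. -/
theorem coeffDer_eq_zero_of_flow_eq_self (d : Derivation ℚ A A) {f : PowerSeries A}
    (h : flow d f = f) : coeffDer d f = 0 := by
  ext n
  rw [coeff_coeffDer, map_zero]
  induction n using Nat.strong_induction_on with
  | _ n ih =>
    have h1 := coeff_flow d f (n + 1)
    rw [h, Finset.Nat.sum_antidiagonal_succ', Finset.sum_eq_single (n, 0)] at h1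
    · simpa using h1
    · intro p hp hne
      have hp' := Finset.HasAntidiagonal.mem_antidiagonal.mp hp
      have hlt : p.1 < n := by
        rcases p with ⟨i, j⟩
        rcases j with _ | j
        · exact absurd (by simp at hp'; simp [hp']) hne
        · simp at hp' ⊢; omega
      rw [Function.iterate_succ_apply, ih p.1 hlt, iterate_map_zero, mul_zero]
    · intro hn
      exact absurd (by simp) hn

end Calculus

/-! ### The formal Gaussian integral: integration by parts, translation, change of variance. -/

section Gauss

variable {A B : Type*} [CommRing A] [Algebra ℚ A] [CommRing B] [Algebra ℚ B]

/-- The derivation of `A[w]` that applies a derivation of `A` to the coefficients. -/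
def polyDer (d : Derivation ℚ A A) : Derivation ℚ (Polynomial A) (Polynomial A) :=
  PolynomialModule.equivPolynomialSelf.compDer d.mapCoeffs

theorem coeff_polyDer (d : Derivation ℚ A A) (p : Polynomial A) (n : ℕ) :
    (polyDer d p).coeff n = d (p.coeff n) := rfl

@[simp]
theorem polyDer_monomial (d : Derivation ℚ A A) (n : ℕ) (a : A) :
    polyDer d (Polynomial.monomial n a) = Polynomial.monomial n (d a) := by
  ext m
  rw [coeff_polyDer, Polynomial.coeff_monomial, Polynomial.coeff_monomial]
  split_ifs <;> simp

@[simp]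
theorem polyDer_C (d : Derivation ℚ A A) (a : A) :
    polyDer d (Polynomial.C a) = Polynomial.C (d a) := polyDer_monomial d 0 a

@[simp]
theorem polyDer_X (d : Derivation ℚ A A) : polyDer d (Polynomial.X : Polynomial A) = 0 := by
  rw [← Polynomial.monomial_one_one_eq_X, polyDer_monomial, Derivation.map_one_eq_zero, map_zero]

/-- The derivation `d/dw` of `A[w]`. -/
def varDer (A : Type*) [CommRing A] [Algebra ℚ A] : Derivation ℚ (Polynomial A) (Polynomial A) :=
  Polynomial.derivative'.restrictScalars ℚ

@[simp]
theorem varDer_apply (p : Polynomial A) : varDer A p = Polynomial.derivative p := rfl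

/-- The Gaussian moments with variance `μ`. -/
def moment (μ : A) (n : ℕ) : A := if Even n then μ ^ (n / 2) * (((n - 1)‼ : ℕ) : A) else 0

/-- The Gaussian integral of a polynomial in `w`, with variance `μ`. -/
def gaussPoly (μ : A) : Polynomial A →ₗ[A] A :=
  Polynomial.lsum fun n => LinearMap.mulRight A (moment μ n)

omit [Algebra ℚ A] in
theorem gaussPoly_monomial (μ : A) (n : ℕ) (a : A) :
    gaussPoly μ (Polynomial.monomial n a) = a * moment μ n := by
  rw [gaussPoly, Polynomial.lsum_apply, Polynomial.sum_monomial_index _ _ (by simp)]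
  rfl

/-- The Gaussian integral with variance `μ`, applied to each coefficient in `t`. -/
def gauss (μ : A) : PowerSeries (Polynomial A) →+ PowerSeries A where
  toFun f := PowerSeries.mk fun n => gaussPoly μ (coeff n f)
  map_zero' := by
    ext n
    simp
  map_add' f g := by
    ext n
    simp

omit [Algebra ℚ A] in
theorem coeff_gauss (μ : A) (f : PowerSeries (Polynomial A)) (n : ℕ) :
    coeff n (gauss μ f) = gaussPoly μ (coeff n f) := by
  rw [gauss, AddMonoidHom.coe_mk, ZeroHom.coe_mk, coeff_mk]

omit [Algebra ℚ A] in
theorem gaussPoly_C_mul (μ a : A) (p : Polynomial A) :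
    gaussPoly μ (Polynomial.C a * p) = a * gaussPoly μ p := by
  rw [← Polynomial.smul_eq_C_mul, map_smul, smul_eq_mul]

omit [Algebra ℚ A] in
theorem gauss_map_C_mul (μ : A) (g : PowerSeries A) (f : PowerSeries (Polynomial A)) :
    gauss μ (map Polynomial.C g * f) = g * gauss μ f := by
  ext n
  rw [coeff_gauss, coeff_mul, coeff_mul, map_sum]
  refine Finset.sum_congr rfl fun p _ => ?_
  rw [coeff_map, gaussPoly_C_mul, coeff_gauss]

omit [Algebra ℚ A] in
theorem gauss_C_mul (μ : A) (a : A) (f : PowerSeries (Polynomial A)) :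
    gauss μ (C (Polynomial.C a) * f) = C a * gauss μ f := by
  rw [← gauss_map_C_mul, map_C]

omit [Algebra ℚ A] in
theorem gauss_X_mul (μ : A) (f : PowerSeries (Polynomial A)) :
    gauss μ (X * f) = X * gauss μ f := by
  rw [← gauss_map_C_mul, map_X]

omit [Algebra ℚ A] in
theorem gaussPoly_one (μ : A) : gaussPoly μ 1 = 1 := by
  have h := gaussPoly_monomial μ 0 1
  rw [Polynomial.monomial_zero_one] at h
  rw [h]
  simp [moment]

omit [Algebra ℚ A] in
@[simp]
theorem gauss_one (μ : A) : gauss μ 1 = 1 := by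
  ext n
  rw [coeff_gauss, coeff_one, coeff_one]
  split_ifs
  · exact gaussPoly_one μ
  · exact map_zero _

omit [Algebra ℚ A] in
theorem derivative_gauss (μ : A) (f : PowerSeries (Polynomial A)) :
    derivative A (gauss μ f) = gauss μ (derivative _ f) := by
  ext n
  rw [coeff_derivative, coeff_gauss, coeff_gauss, coeff_derivative,
    show ((n : Polynomial A) + 1) = Polynomial.C ((n : A) + 1) by simp, mul_comm,
    mul_comm _ (Polynomial.C _), gaussPoly_C_mul]

omit [Algebra ℚ A] in
theorem constantCoeff_gauss (μ : A) (f : PowerSeries (Polynomial A)) :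
    constantCoeff (gauss μ f) = gaussPoly μ (constantCoeff f) := by
  rw [← coeff_zero_eq_constantCoeff_apply, coeff_gauss, coeff_zero_eq_constantCoeff_apply]

omit [Algebra ℚ A] in
theorem moment_succ_succ (μ : A) (n : ℕ) :
    moment μ (n + 2) = μ * ((n + 1) * moment μ n) := by
  unfold moment
  by_cases h : Even n
  · rw [if_pos h, if_pos (by simpa [Nat.even_add_one] using h)]
    rw [show (n + 2) / 2 = n / 2 + 1 by omega, pow_succ]
    rcases n with _ | n
    · simp
    · rw [show n + 1 + 2 - 1 = n + 2 by omega, Nat.doubleFactorial_add_two,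
        show n + 1 - 1 = n by omega]
      push_cast
      ring
  · rw [if_neg h, if_neg (by simpa [Nat.even_add_one] using h)]
    ring

/-- Integration by parts. -/
theorem gauss_varDer {μ δ : A} (h : δ * μ = 1) (f : PowerSeries (Polynomial A)) :
    gauss μ (coeffDer (varDer A) f) = C δ * gauss μ (C Polynomial.X * f) := by
  have key : ∀ p : Polynomial A,
      gaussPoly μ (Polynomial.derivative p) = δ * gaussPoly μ (Polynomial.X * p) := by
    intro p
    induction p using Polynomial.induction_on' with
    | add p q hp hq => rw [map_add, map_add, mul_add, map_add, hp, hq, mul_add]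
    | monomial n a =>
      rw [Polynomial.derivative_monomial, Polynomial.X_mul_monomial, gaussPoly_monomial,
        gaussPoly_monomial]
      rcases n with _ | n
      · simp [moment]
      · rw [moment_succ_succ, Nat.add_sub_cancel]
        push_cast
        linear_combination (-a * (n + 1) * moment μ n) * h
  ext n
  rw [coeff_gauss, coeff_coeffDer, coeff_C_mul, coeff_gauss, coeff_C_mul, varDer_apply, key]

/-- The exponent `δ c w t - δ c² t² / 2`. -/
def gaussShift (δ c : A) : PowerSeries (Polynomial A) :=
  C (Polynomial.C (δ * c) * Polynomial.X) * X
    - C (Polynomial.C (algebraMap ℚ A (1 / 2) * (δ * c ^ 2))) * X ^ 2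

omit [Algebra ℚ A] [Algebra ℚ B] in
theorem constantCoeff_mul_X (f : PowerSeries A) : constantCoeff (f * X) = 0 := by
  rw [map_mul, constantCoeff_X, mul_zero]

theorem constantCoeff_gaussShift (δ c : A) : constantCoeff (gaussShift δ c) = 0 := by
  rw [gaussShift, sq (X : PowerSeries (Polynomial A)), ← mul_assoc, ← sub_mul, constantCoeff_mul_X]

/-- Translation of the variable in a Gaussian integral. -/
theorem gauss_flow_varDer {μ δ : A} (h : δ * μ = 1) (c : A) (f : PowerSeries (Polynomial A)) :
    gauss μ (flow (Polynomial.C c • varDer A) f) =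
      gauss μ (f * formalExp (gaussShift δ c)) := by
  have h0 := constantCoeff_gaussShift δ c
  refine eq_of_derivative_comp
    (fun f => derivative _ f + coeffDer (Polynomial.C c • varDer A) f)
    (U := fun f => gauss μ (flow (Polynomial.C c • varDer A) f))
    (V := fun f => gauss μ (f * formalExp (gaussShift δ c))) ?_ ?_ ?_ f
  · intro f
    rw [constantCoeff_gauss, constantCoeff_gauss, constantCoeff_flow, map_mul,
      constantCoeff_formalExp h0, mul_one]
  · intro f
    rw [derivative_gauss, derivative_flow]
  · intro f
    have e1 : coeffDer (Polynomial.C c • varDer A) f =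
        C (Polynomial.C c) * coeffDer (varDer A) f := by
      ext n
      rw [coeff_coeffDer, coeff_C_mul, coeff_coeffDer, Derivation.smul_apply, smul_eq_mul]
    have e2 : coeffDer (varDer A) (gaussShift δ c) = C (Polynomial.C (δ * c)) * X := by
      rw [gaussShift, map_sub, coeffDer_mul, coeffDer_mul, coeffDer_C, coeffDer_C,
        sq (X : PowerSeries (Polynomial A)),
        coeffDer_mul, coeffDer_X, varDer_apply, varDer_apply, Polynomial.derivative_C,
        Polynomial.derivative_C_mul, Polynomial.derivative_X, mul_one, map_zero]
      ring
    have e3 : derivative _ (gaussShift δ c) =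
        C (Polynomial.C (δ * c)) * C Polynomial.X - C (Polynomial.C (δ * c ^ 2)) * X := by
      have hh : (algebraMap ℚ A (1 / 2)) * 2 = 1 := by
        rw [show (2 : A) = algebraMap ℚ A 2 from (map_ofNat _ 2).symm, ← map_mul]
        norm_num
      have : C (Polynomial.C (algebraMap ℚ A (1 / 2))) * 2 = (1 : PowerSeries (Polynomial A)) := by
        rw [show (2 : PowerSeries (Polynomial A)) = C (Polynomial.C 2) by
          rw [map_ofNat, map_ofNat], ← map_mul,
          ← map_mul, hh, map_one, map_one]
      simp only [gaussShift, map_sub, derivative_mul, derivative_C, derivative_X, sq, map_mul]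
      linear_combination (-C (Polynomial.C δ) * C (Polynomial.C c) ^ 2 * X) * this
    -- The t-derivative of the exponential brings down δcw - δc²t. Integration by parts trades δw
    -- for d/dw, and the part of d/dw that hits the exponential cancels -δc²t.
    have ibp := gauss_varDer h (f * formalExp (gaussShift δ c))
    rw [derivative_gauss, derivative_mul, derivative_formalExp h0, e1, e3, add_mul, map_add]
    rw [coeffDer_mul, coeffDer_formalExp _ h0, e2] at ibp
    set E := formalExp (gaussShift δ c)
    have i1 : f * ((C (Polynomial.C (δ * c)) * C Polynomial.X -
        C (Polynomial.C (δ * c ^ 2)) * X) * E) =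
        C (Polynomial.C (δ * c)) * (C Polynomial.X * (f * E)) -
          C (Polynomial.C (δ * c ^ 2)) * (X * (f * E)) := by ring
    have i2 : f * (C (Polynomial.C (δ * c)) * X * E) + E * coeffDer (varDer A) f =
        C (Polynomial.C (δ * c)) * (X * (f * E)) + coeffDer (varDer A) f * E := by ring
    rw [i2, map_add, gauss_C_mul, gauss_X_mul] at ibp
    rw [i1, map_add, map_sub, gauss_C_mul, gauss_C_mul, gauss_X_mul, mul_assoc, gauss_C_mul,
      mul_comm E]
    simp only [map_mul, map_pow] at ibp ⊢
    linear_combination (-C c) * ibp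

/-- Changing the variance amounts to rescaling w: the moment of wⁿ has degree n/2 in μ, so d
multiplies it by -ρn, and n is the eigenvalue of w d/dw on wⁿ. -/
theorem polyDer_gauss (d : Derivation ℚ A A) {μ ρ : A} (h : d μ = -2 * ρ * μ)
    (f : PowerSeries (Polynomial A)) :
    coeffDer d (gauss μ f) = gauss μ (coeffDer (polyDer d) f)
      - C ρ * gauss μ (C Polynomial.X * coeffDer (varDer A) f) := by
  have hm : ∀ n, d (moment μ n) = -ρ * n * moment μ n := by
    intro n
    unfold moment
    split_ifs with hn
    · obtain ⟨k, rfl⟩ := hn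
      rw [← two_mul, Nat.mul_div_cancel_left k two_pos, Derivation.leibniz, Derivation.leibniz_pow,
        Derivation.map_natCast, h]
      rcases k with _ | k
      · simp
      · simp only [smul_eq_mul, nsmul_eq_mul, Nat.add_sub_cancel, mul_zero, zero_add]
        push_cast
        ring
    · simp
  have key : ∀ p : Polynomial A, d (gaussPoly μ p) = gaussPoly μ (polyDer d p)
      - ρ * gaussPoly μ (Polynomial.X * Polynomial.derivative p) := by
    intro p
    induction p using Polynomial.induction_on' with
    | add p q hp hq => simp only [map_add, mul_add, hp, hq]; ring
    | monomial n a =>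
      rw [Polynomial.derivative_monomial, Polynomial.X_mul_monomial, gaussPoly_monomial,
        polyDer_monomial, gaussPoly_monomial, gaussPoly_monomial, Derivation.leibniz, hm]
      rcases n with _ | n
      · simp [mul_comm]
      · rw [Nat.sub_add_cancel (by omega)]
        simp only [smul_eq_mul]
        ring
  ext n
  rw [coeff_coeffDer, coeff_gauss, key, map_sub, coeff_gauss, coeff_coeffDer, coeff_C_mul,
    coeff_gauss, coeff_C_mul, coeff_coeffDer, varDer_apply]

theorem flow_gauss (d : Derivation ℚ A A) {μ : A} (h : d μ = 0)
    (f : PowerSeries (Polynomial A)) :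
    flow d (gauss μ f) = gauss μ (flow (polyDer d) f) := by
  have hc : ∀ f, coeffDer d (gauss μ f) = gauss μ (coeffDer (polyDer d) f) := fun f => by
    rw [polyDer_gauss d (ρ := 0) (by rw [h]; ring) f]
    simp
  refine eq_of_derivative_comp (fun f => derivative _ f + coeffDer (polyDer d) f)
    (U := fun f => flow d (gauss μ f)) (V := fun f => gauss μ (flow (polyDer d) f)) ?_ ?_ ?_ f
  · intro f
    rw [constantCoeff_flow, constantCoeff_gauss, constantCoeff_gauss, constantCoeff_flow]
  · intro f
    rw [derivative_flow, derivative_gauss, hc, ← map_add]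
  · intro f
    rw [derivative_gauss, derivative_flow]

omit [Algebra ℚ A] [Algebra ℚ B] in
theorem map_gauss (r : A →+* B) (μ : A) (f : PowerSeries (Polynomial A)) :
    map r (gauss μ f) = gauss (r μ) (map (Polynomial.mapRingHom r) f) := by
  have key : ∀ p : Polynomial A, r (gaussPoly μ p) = gaussPoly (r μ) (Polynomial.mapRingHom r p) := by
    intro p
    induction p using Polynomial.induction_on' with
    | add p q hp hq => simp only [map_add, hp, hq]
    | monomial n a =>
      rw [Polynomial.coe_mapRingHom, Polynomial.map_monomial, gaussPoly_monomial,
        gaussPoly_monomial, map_mul]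
      congr 1
      unfold moment
      split_ifs <;> simp
  ext n
  rw [coeff_map, coeff_gauss, coeff_gauss, coeff_map, key]

omit [Algebra ℚ A] in
theorem formalGauss_eq {K : Type*} [Field K] [Algebra K A] (lam : K)
    (f : PowerSeries (Polynomial A)) :
    formalGauss lam f = gauss (algebraMap K A lam⁻¹) f := by
  ext n
  rw [formalGauss, coeff_mk, coeff_gauss, gaussPoly, Polynomial.lsum_apply]
  refine congrArg (Polynomial.sum _) ?_
  funext j a
  rw [LinearMap.mulRight_apply]
  congr 1
  unfold gaussMoment moment
  split_ifs
  · rw [map_mul, map_pow, map_natCast]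
  · exact map_zero _

end Gauss

/-! ### Polylogarithms of nonpositive order as polynomials in p = Li₀(z). -/

section Polylog

/-- The polynomials with `Li_{-m}(z) = P_m(z / (1 - z))`. -/
def polylogPoly : ℕ → Polynomial ℚ
  | 0 => Polynomial.X
  | m + 1 => (Polynomial.X + Polynomial.X ^ 2) * Polynomial.derivative (polylogPoly m)

theorem sum_antidiagonal_choose_succ {M : Type*} [AddCommMonoid M] (f : ℕ → ℕ → M) (n : ℕ) :
    ∑ q ∈ Finset.HasAntidiagonal.antidiagonal (n + 1), (n + 1).choose q.1 • f q.1 q.2 =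
      ∑ q ∈ Finset.HasAntidiagonal.antidiagonal n, n.choose q.1 • f q.1 (q.2 + 1) +
      ∑ q ∈ Finset.HasAntidiagonal.antidiagonal n, n.choose q.1 • f (q.1 + 1) q.2 := by
  rw [Finset.sum_antidiagonal_choose_succ_nsmul]
  congr 1
  refine Finset.sum_congr rfl fun q hq => ?_
  rw [Finset.HasAntidiagonal.mem_antidiagonal] at hq
  rw [← hq, Nat.choose_symm_add]

/-- The generating series G = ∑ Li_{-n}(z) sⁿ/n! = z eˢ/(1 - z eˢ) satisfies G = z eˢ(1 + G); this
is its n-th coefficient with z = p/(1 + p). -/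
theorem polylogPoly_rec (n : ℕ) :
    (1 + Polynomial.X) * polylogPoly n = Polynomial.X *
      (1 + ∑ q ∈ Finset.HasAntidiagonal.antidiagonal n, n.choose q.1 • polylogPoly q.1) := by
  induction n with
  | zero => simp [polylogPoly]; ring
  | succ n ih =>
    have hd := congrArg Polynomial.derivative ih
    rw [sum_antidiagonal_choose_succ (fun i _ => polylogPoly i) n]
    simp only [polylogPoly, Polynomial.derivative_mul, Polynomial.derivative_add,
      Polynomial.derivative_one, Polynomial.derivative_X, map_sum, map_nsmul] at hd ⊢
    have hs : ∑ q ∈ Finset.HasAntidiagonal.antidiagonal n, n.choose q.1 •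
        ((Polynomial.X + Polynomial.X ^ 2) * Polynomial.derivative (polylogPoly q.1)) =
        (Polynomial.X + Polynomial.X ^ 2) * ∑ q ∈ Finset.HasAntidiagonal.antidiagonal n,
          n.choose q.1 • Polynomial.derivative (polylogPoly q.1) := by
      rw [Finset.mul_sum]
      exact Finset.sum_congr rfl fun q _ => (mul_smul_comm _ _ _).symm
    rw [hs]
    linear_combination (Polynomial.X + Polynomial.X ^ 2) * hd - Polynomial.X * ih

/-- The same relation G = z eˢ(1 + G), with the denominators (1 - z)^(n+1) cleared. -/
theorem polylogNum_rec (n : ℕ) :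
    polylogNum n = Polynomial.X * ((1 - Polynomial.X) ^ (n + 1) +
      ∑ q ∈ Finset.HasAntidiagonal.antidiagonal n,
        n.choose q.1 • (polylogNum q.1 * (1 - Polynomial.X) ^ q.2)) := by
  induction n with
  | zero => simp [polylogNum]
  | succ n ih =>
    have hd := congrArg Polynomial.derivative ih
    rw [sum_antidiagonal_choose_succ (fun i j => polylogNum i * (1 - Polynomial.X) ^ j) n]
    rw [polylogNum]
    simp only [Polynomial.derivative_mul, Polynomial.derivative_add, map_sum, map_nsmul,
      Polynomial.derivative_X, Polynomial.derivative_pow, map_sub, Polynomial.derivative_one] at hd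
    have hs : ∑ q ∈ Finset.HasAntidiagonal.antidiagonal n, n.choose q.1 •
          (polylogNum (q.1 + 1) * (1 - Polynomial.X) ^ q.2) =
        Polynomial.X * (1 - Polynomial.X) * ∑ q ∈ Finset.HasAntidiagonal.antidiagonal n,
          n.choose q.1 • (Polynomial.derivative (polylogNum q.1) * (1 - Polynomial.X) ^ q.2 +
            polylogNum q.1 * (Polynomial.C (q.2 : ℚ) * (1 - Polynomial.X) ^ (q.2 - 1) * (0 - 1)))
        + ((n : Polynomial ℚ) + 1) * Polynomial.X * ∑ q ∈ Finset.HasAntidiagonal.antidiagonal n,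
          n.choose q.1 • (polylogNum q.1 * (1 - Polynomial.X) ^ q.2) := by
      rw [Finset.mul_sum, Finset.mul_sum, ← Finset.sum_add_distrib]
      refine Finset.sum_congr rfl fun q hq => ?_
      rw [Finset.HasAntidiagonal.mem_antidiagonal] at hq
      rw [← hq, polylogNum]
      simp only [nsmul_eq_mul]
      rcases q with ⟨i, _ | j⟩
      · simp
      · simp only [Nat.add_sub_cancel, pow_succ]
        push_cast
        simp
        ring
    have hs2 : ∑ q ∈ Finset.HasAntidiagonal.antidiagonal n, n.choose q.1 •
          (polylogNum q.1 * (1 - Polynomial.X) ^ (q.2 + 1)) =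
        (1 - Polynomial.X) * ∑ q ∈ Finset.HasAntidiagonal.antidiagonal n, n.choose q.1 •
          (polylogNum q.1 * (1 - Polynomial.X) ^ q.2) := by
      rw [Finset.mul_sum]
      refine Finset.sum_congr rfl fun q hq => ?_
      simp only [nsmul_eq_mul]
      ring
    rw [hs, hs2]
    rw [Nat.add_sub_cancel] at hd
    push_cast at hd
    have hC : Polynomial.C ((n : ℚ) + 1) = (n : Polynomial ℚ) + 1 := by simp
    rw [hC] at hd
    simp only [pow_succ] at hd ih ⊢
    linear_combination (Polynomial.X * (1 - Polynomial.X)) * hd +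
      ((n : Polynomial ℚ) + 1) * Polynomial.X * ih

variable {A B : Type*} [CommRing A] [Algebra ℚ A] [CommRing B] [Algebra ℚ B]

/-- `Li_{-m}` as a function of `p = Li_0`. -/
def li (p : A) (m : ℕ) : A := Polynomial.aeval p (polylogPoly m)

theorem map_li (r : A →+* B) (p : A) (m : ℕ) : r (li p m) = li (r p) m :=
  (Polynomial.aeval_algHom_apply r.toRatAlgHom p (polylogPoly m)).symm

@[simp]
theorem li_zero (p : A) : li p 0 = p := by simp [li, polylogPoly]

@[simp]
theorem li_one (p : A) : li p 1 = p + p ^ 2 := by simp [li, polylogPoly]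

theorem li_rec (p : A) (n : ℕ) : (1 + p) * li p n =
    p * (1 + ∑ q ∈ Finset.HasAntidiagonal.antidiagonal n, (n.choose q.1 : A) * li p q.1) := by
  have h := congrArg (Polynomial.aeval p) (polylogPoly_rec n)
  simpa [li] using h

theorem derivation_li (d : Derivation ℚ A A) {p ε : A} (h : d p = ε * (p + p ^ 2)) (m : ℕ) :
    d (li p m) = ε * li p (m + 1) := by
  rw [li, Derivation.map_aeval, h, li, polylogPoly]
  simp
  ring

/-- An arbitrary K has no derivation z d/dz, so the two descriptions are compared through their
common recursion. In it the unknown of index n reappears with coefficient z, hence is determined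
because 1 - z ≠ 0. -/
theorem polylogNeg_eq {K : Type*} [Field K] [Algebra ℚ K] {z : K} (hz : z ≠ 1) (m : ℕ) :
    polylogNeg m z = li (z / (1 - z)) m := by
  have h1 : 1 - z ≠ 0 := sub_ne_zero.mpr hz.symm
  induction m using Nat.strong_induction_on with
  | _ n ih =>
    have hrec : polylogNeg n z = z * (1 + ∑ q ∈ Finset.HasAntidiagonal.antidiagonal n,
        (n.choose q.1 : K) * polylogNeg q.1 z) := by
      have h := congrArg (fun P => Polynomial.aeval z P / (1 - z) ^ (n + 1)) (polylogNum_rec n)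
      simp only [map_mul, map_add, map_pow, map_sub, map_one, Polynomial.aeval_X, map_sum,
        map_nsmul] at h
      rw [polylogNeg, h, mul_div_assoc, add_div, div_self (pow_ne_zero _ h1), Finset.sum_div]
      congr 2
      refine Finset.sum_congr rfl fun q hq => ?_
      rw [Finset.HasAntidiagonal.mem_antidiagonal] at hq
      rw [polylogNeg, nsmul_eq_mul, ← hq]
      field_simp
      ring
    have hli := li_rec (z / (1 - z)) n
    have hp : 1 + z / (1 - z) = 1 / (1 - z) := by
      field_simp
      ring
    rw [hp] at hli
    have hli' : li (z / (1 - z)) n = z * (1 + ∑ q ∈ Finset.HasAntidiagonal.antidiagonal n,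
        (n.choose q.1 : K) * li (z / (1 - z)) q.1) := by
      field_simp at hli
      exact hli
    have hmem : (n, 0) ∈ Finset.HasAntidiagonal.antidiagonal n := by simp
    rw [← Finset.add_sum_erase _ _ hmem] at hrec hli'
    have hs : ∀ q ∈ (Finset.HasAntidiagonal.antidiagonal n).erase (n, 0),
        (n.choose q.1 : K) * polylogNeg q.1 z = (n.choose q.1 : K) * li (z / (1 - z)) q.1 := by
      intro q hq
      rw [Finset.mem_erase, Finset.HasAntidiagonal.mem_antidiagonal] at hq
      rw [ih q.1]
      rcases q with ⟨i, _ | j⟩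
      · exact absurd (by simpa using hq.2) (by simpa using hq.1)
      · have := hq.2
        simp at this ⊢
        omega
    rw [Finset.sum_congr rfl hs] at hrec
    simp only [Nat.choose_self, Nat.cast_one, one_mul] at hrec hli'
    have hd : (1 - z) * (polylogNeg n z - li (z / (1 - z)) n) = 0 := by
      linear_combination hrec - hli'
    exact sub_eq_zero.mp ((mul_eq_zero.mp hd).resolve_left h1)

end Polylog

/-! ### The exponent of ψ, its two partial derivatives, and the factor (1 - z e^{xt})/(1 - z). -/

section Psi

variable {A B : Type*} [CommRing A] [Algebra ℚ A] [CommRing B] [Algebra ℚ B]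

/-- The pairs `(k, ℓ)` with `2k + ℓ = n`, written as in the definition of `psiExponent`. -/
def weightPairs (n : ℕ) : Finset (ℕ × ℕ) :=
  (Finset.range (n + 1) ×ˢ Finset.range (n + 1)).filter fun p => 2 * p.1 + p.2 = n

theorem mem_weightPairs {n : ℕ} {p : ℕ × ℕ} : p ∈ weightPairs n ↔ 2 * p.1 + p.2 = n := by
  simp only [weightPairs, Finset.mem_filter, Finset.mem_product, Finset.mem_range]
  omega

/-- The exponent of `ψ` in terms of `p = Li_0(z)`. -/
def psiE (p x : A) : PowerSeries A :=
  PowerSeries.mk fun n =>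
    if n = 0 then 0 else
      -∑ q ∈ weightPairs (n + 2),
        algebraMap ℚ A (bernoulli q.1 / ((q.2 ! : ℚ) * (q.1 ! : ℚ))) * x ^ q.2 *
          li p (q.1 + q.2 - 2)

/-- The series `ψ` in terms of `p = Li_0(z)`. -/
def psiP (p x : A) : PowerSeries A := formalExp (psiE p x)

@[simp]
theorem constantCoeff_psiE (p x : A) : constantCoeff (psiE p x) = 0 := by
  rw [← coeff_zero_eq_constantCoeff_apply, psiE, coeff_mk, if_pos rfl]

theorem psi_eq_psiP {K : Type*} [Field K] [Algebra ℚ K] [Algebra K A] {z : K} (hz : z ≠ 1)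
    (x : A) : psi x z = psiP (algebraMap K A (z / (1 - z))) x := by
  rw [psi, psiP]
  congr 1
  ext n
  rw [psiExponent, psiE, coeff_mk, coeff_mk]
  split_ifs with h
  · rfl
  · simp only [polylogNeg_eq hz, map_li]
    rfl

theorem map_psiE (r : A →+* B) (p x : A) : map r (psiE p x) = psiE (r p) (r x) := by
  ext n
  rw [coeff_map, psiE, psiE, coeff_mk, coeff_mk]
  split_ifs
  · exact map_zero r
  · simp only [map_neg, map_sum, map_mul, map_pow, map_li, RingHom.map_rat_algebraMap]

theorem map_psiP (r : A →+* B) (p x : A) : map r (psiP p x) = psiP (r p) (r x) := by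
  rw [psiP, psiP, map_formalExp r (constantCoeff_psiE p x), map_psiE]

/-- The derivative of the exponent in the argument `x`. -/
def psiDx (p x : A) : PowerSeries A :=
  PowerSeries.mk fun n =>
    if n = 0 then 0 else
      -∑ q ∈ weightPairs (n + 2),
        algebraMap ℚ A (bernoulli q.1 / ((q.2 ! : ℚ) * (q.1 ! : ℚ))) * (q.2 * x ^ (q.2 - 1)) *
          li p (q.1 + q.2 - 2)

/-- The logarithmic derivative of the exponent in the shape `z`. -/
def psiDz (p x : A) : PowerSeries A :=
  PowerSeries.mk fun n =>
    if n = 0 then 0 else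
      -∑ q ∈ weightPairs (n + 2),
        algebraMap ℚ A (bernoulli q.1 / ((q.2 ! : ℚ) * (q.1 ! : ℚ))) * x ^ q.2 *
          li p (q.1 + q.2 - 2 + 1)

theorem coeffDer_psiE_eq (d : Derivation ℚ A A) {p ε : A} (h : d p = ε * (p + p ^ 2)) (x : A) :
    coeffDer d (psiE p x) = C (d x) * psiDx p x + C ε * psiDz p x := by
  ext n
  rw [coeff_coeffDer, map_add, coeff_C_mul, coeff_C_mul, psiE, psiDx, psiDz, coeff_mk, coeff_mk,
    coeff_mk]
  split_ifs
  · simp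
  · rw [map_neg, map_sum, mul_neg, mul_neg, Finset.mul_sum, Finset.mul_sum, ← neg_add,
      ← Finset.sum_add_distrib]
    congr 1
    refine Finset.sum_congr rfl fun q _ => ?_
    rw [Derivation.leibniz, Derivation.leibniz, Derivation.map_algebraMap, derivation_li d h,
      Derivation.leibniz_pow]
    simp only [smul_eq_mul, nsmul_eq_mul]
    ring

/-- On the full double sum ∂x equals t·z∂z: lowering ℓ by one lowers the weight 2k + ℓ by one, and z
d/dz restores the order of Li. The correction is z∂z of the weight-2 terms, which the exponent of ψ
omits. -/
theorem psiDx_eq (p x : A) :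
    psiDx p x = X * (psiDz p x
      - C (algebraMap ℚ A (1 / 2) * (x ^ 2 * (p + p ^ 2) - p))) := by
  ext n
  rcases n with _ | n
  · rw [coeff_zero_X_mul, psiDx, coeff_mk, if_pos rfl]
  · rw [coeff_succ_X_mul, psiDx, coeff_mk, if_neg n.succ_ne_zero, map_sub, psiDz, coeff_mk]
    rcases n with _ | n
    · rw [if_pos rfl, coeff_C, if_pos rfl]
      -- The partners of these two pairs have weight 2 and are cut off in `psiDz`; they produce the
      -- correction term.
      have : weightPairs (0 + 1 + 2) = {(1, 1), (0, 3)} := by decide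
      rw [this, Finset.sum_pair (by decide)]
      have e1 : bernoulli 1 / ((1 ! : ℚ) * (1 ! : ℚ)) = -(1 / 2) := by
        norm_num [bernoulli_one, Nat.factorial]
      have e2 : bernoulli 0 / ((3 ! : ℚ) * (0 ! : ℚ)) = 1 / 2 * (1 / 3) := by
        norm_num [bernoulli_zero, Nat.factorial]
      have h3 : algebraMap ℚ A (1 / 3) * 3 = 1 := by
        rw [show (3 : A) = algebraMap ℚ A 3 from (map_ofNat _ 3).symm, ← map_mul]
        norm_num
      dsimp only
      rw [e1, e2, map_neg, map_mul, show 1 + 1 - 2 = 0 from rfl, show 0 + 3 - 2 = 1 from rfl,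
        show 3 - 1 = 2 from rfl, li_zero, li_one]
      push_cast
      linear_combination (-algebraMap ℚ A (1 / 2) * x ^ 2 * (p + p ^ 2)) * h3
    · rw [if_neg n.succ_ne_zero, coeff_C, if_neg n.succ_ne_zero, sub_zero]
      congr 1
      rw [← Finset.sum_filter_of_ne (p := fun q : ℕ × ℕ => q.2 ≠ 0)
        fun q _ hq h0 => hq (by rw [h0]; simp)]
      refine Finset.sum_nbij' (fun q => (q.1, q.2 - 1)) (fun q => (q.1, q.2 + 1)) ?_ ?_ ?_ ?_ ?_
      · intro q hq
        rw [Finset.mem_filter, mem_weightPairs] at hq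
        rw [mem_weightPairs]
        dsimp only
        omega
      · intro q hq
        rw [mem_weightPairs] at hq
        rw [Finset.mem_filter, mem_weightPairs]
        dsimp only
        omega
      · intro q hq
        rw [Finset.mem_filter] at hq
        ext
        · rfl
        · dsimp only
          omega
      · intro q _
        rfl
      · rintro ⟨k, l⟩ hq
        rw [Finset.mem_filter, mem_weightPairs] at hq
        obtain ⟨l, rfl⟩ : ∃ m, l = m + 1 := ⟨l - 1, by omega⟩
        dsimp only at hq ⊢
        rw [Nat.add_sub_cancel, show k + l - 2 + 1 = k + (l + 1) - 2 by omega,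
          Nat.factorial_succ]
        have : algebraMap ℚ A (bernoulli k / (((l + 1) * l ! : ℕ) * (k ! : ℚ))) * ((l + 1 : ℕ) : A) =
            algebraMap ℚ A (bernoulli k / ((l ! : ℚ) * (k ! : ℚ))) := by
          rw [← map_natCast (algebraMap ℚ A), ← map_mul]
          congr 1
          push_cast
          field_simp
        rw [← this]
        ring

/-! ### The shift of the argument -/

/-- The series `e^{x t}`. -/
def ex (x : A) : PowerSeries A := formalExp (C x * X)

omit [Algebra ℚ A] in
theorem constantCoeff_C_mul_X (x : A) : constantCoeff (C x * X) = 0 := by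
  rw [map_mul, constantCoeff_X, mul_zero]

@[simp]
theorem constantCoeff_ex (x : A) : constantCoeff (ex x) = 1 :=
  constantCoeff_formalExp (constantCoeff_C_mul_X x)

theorem derivative_ex (x : A) : derivative A (ex x) = C x * ex x := by
  rw [ex, derivative_formalExp (constantCoeff_C_mul_X x), derivative_mul, derivative_C,
    derivative_X]
  ring

theorem ex_add (x y : A) : ex (x + y) = ex x * ex y := by
  rw [ex, ex, ex, ← formalExp_add (constantCoeff_C_mul_X x) (constantCoeff_C_mul_X y), map_add,
    add_mul]

theorem coeff_ex (x : A) (n : ℕ) : coeff n (ex x) = algebraMap ℚ A (1 / (n ! : ℚ)) * x ^ n := by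
  revert n
  suffices h : ex x = PowerSeries.mk fun n => algebraMap ℚ A (1 / (n ! : ℚ)) * x ^ n by
    intro n
    rw [h, coeff_mk]
  refine eq_of_derivative_eq_mul (h := C x) ?_ (derivative_ex x) ?_
  · rw [constantCoeff_ex, ← coeff_zero_eq_constantCoeff_apply, coeff_mk]
    simp
  · ext n
    rw [coeff_derivative, coeff_mk, coeff_C_mul, coeff_mk]
    have : algebraMap ℚ A (1 / ((n + 1)! : ℚ)) * ((n : A) + 1) = algebraMap ℚ A (1 / (n ! : ℚ)) := by
      rw [show ((n : A) + 1) = algebraMap ℚ A ((n : ℚ) + 1) by simp, ← map_mul]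
      congr 1
      rw [Nat.factorial_succ]
      push_cast
      field_simp
    rw [← this]
    ring

/-- The series `(1 - z e^{x t}) / (1 - z)`. -/
def shiftFactor (p x : A) : PowerSeries A := C (1 + p) - C p * ex x

/-- The logarithm of `shiftFactor`. -/
def shiftLog (p x : A) : PowerSeries A :=
  PowerSeries.mk fun n =>
    if n = 0 then 0 else -(algebraMap ℚ A (1 / (n ! : ℚ)) * x ^ n * li p (n - 1))

theorem constantCoeff_shiftLog (p x : A) : constantCoeff (shiftLog p x) = 0 := by
  rw [← coeff_zero_eq_constantCoeff_apply, shiftLog, coeff_mk, if_pos rfl]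

/-- The logarithmic derivative of 1 - z e^{xt} in t is -x ∑ Li_{-n}(z)(xt)ⁿ/n!, by the generating
series behind `li_rec`. -/
theorem formalExp_shiftLog (p x : A) : formalExp (shiftLog p x) = shiftFactor p x := by
  symm
  refine formalExp_unique (constantCoeff_shiftLog p x) ?_ ?_
  · simp [shiftFactor]
  · set g : PowerSeries A := PowerSeries.mk fun n =>
      algebraMap ℚ A (1 / (n ! : ℚ)) * x ^ n * li p n with hg
    have h1 : derivative A (shiftLog p x) = -(C x * g) := by
      ext n
      rw [coeff_derivative, shiftLog, coeff_mk, if_neg n.succ_ne_zero, map_neg, coeff_C_mul, hg,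
        coeff_mk, Nat.add_sub_cancel]
      have : algebraMap ℚ A (1 / ((n + 1)! : ℚ)) * ((n : A) + 1) =
          algebraMap ℚ A (1 / (n ! : ℚ)) := by
        rw [show ((n : A) + 1) = algebraMap ℚ A ((n : ℚ) + 1) by simp, ← map_mul]
        congr 1
        rw [Nat.factorial_succ]
        push_cast
        field_simp
      rw [← this]
      ring
    have h2 : C (1 + p) * g = C p * (ex x + g * ex x) := by
      ext n
      rw [coeff_C_mul, coeff_C_mul, map_add, coeff_mul, hg, coeff_mk, mul_left_comm, li_rec,
        coeff_ex]
      have : ∀ q ∈ Finset.HasAntidiagonal.antidiagonal n,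
          coeff q.1 g * coeff q.2 (ex x) = algebraMap ℚ A (1 / (n ! : ℚ)) * x ^ n *
            ((n.choose q.1 : A) * li p q.1) := by
        intro q hq
        rw [Finset.HasAntidiagonal.mem_antidiagonal] at hq
        rw [coeff_ex, hg, coeff_mk, ← hq]
        have h3 : algebraMap ℚ A (1 / (q.1 ! : ℚ)) * algebraMap ℚ A (1 / (q.2 ! : ℚ)) =
            algebraMap ℚ A (1 / ((q.1 + q.2)! : ℚ)) * (((q.1 + q.2).choose q.1 : ℕ) : A) := by
          rw [← map_natCast (algebraMap ℚ A), ← map_mul, ← map_mul]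
          congr 1
          have h4 := Nat.add_choose_mul_factorial_mul_factorial q.1 q.2
          rw [← h4, ← Nat.choose_symm_add]
          have : (((q.1 + q.2).choose q.1 : ℕ) : ℚ) ≠ 0 := by
            exact_mod_cast (Nat.choose_pos (Nat.le_add_right _ _)).ne'
          push_cast
          field_simp
        rw [pow_add]
        linear_combination (x ^ q.1 * x ^ q.2 * li p q.1) * h3
      rw [Finset.sum_congr rfl this, ← Finset.mul_sum]
      ring
    rw [h1, shiftFactor, map_sub, derivative_C, derivative_mul, derivative_C, derivative_ex]
    linear_combination C x * h2

end Psi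

/-! ### The difference equation of ψ in its argument. -/

section Shift

variable {A B : Type*} [CommRing A] [Algebra ℚ A] [CommRing B] [Algebra ℚ B]

/-- The series `e^{a t + b t²}`. -/
def quadExp (a b : A) : PowerSeries A := formalExp (C a * X + C b * X ^ 2)

omit [Algebra ℚ A] in
theorem constantCoeff_quad (a b : A) : constantCoeff (C a * X + C b * X ^ 2) = 0 := by
  rw [sq, ← mul_assoc, ← add_mul, map_mul, constantCoeff_X, mul_zero]

theorem quadExp_add (a b a' b' : A) : quadExp (a + a') (b + b') = quadExp a b * quadExp a' b' := by
  rw [quadExp, quadExp, quadExp, ← formalExp_add (constantCoeff_quad a b) (constantCoeff_quad a' b')]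
  congr 1
  rw [map_add, map_add]
  ring

theorem ex_eq_quadExp (x : A) : ex x = quadExp x 0 := by
  rw [ex, quadExp, map_zero, zero_mul, add_zero]

theorem map_quadExp (r : A →+* B) (a b : A) : map r (quadExp a b) = quadExp (r a) (r b) := by
  rw [quadExp, map_formalExp r (constantCoeff_quad a b), quadExp, map_add, map_mul, map_mul, map_pow,
    map_C, map_C, map_X]

theorem coeffDer_quadExp (d : Derivation ℚ A A) (a b : A) :
    coeffDer d (quadExp a b) = (C (d a) * X + C (d b) * X ^ 2) * quadExp a b := by
  rw [quadExp, coeffDer_formalExp d (constantCoeff_quad a b)]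
  congr 1
  rw [map_add, coeffDer_mul, coeffDer_mul, coeffDer_C, coeffDer_C, sq, coeffDer_mul, coeffDer_X]
  ring

theorem flow_quadExp (d : Derivation ℚ A A) {a b c : A} (ha : d a = c) (hc : d c = 0)
    (hb : d b = 0) : flow d (quadExp a b) = quadExp a (b + c) := by
  rw [quadExp, flow_formalExp d (constantCoeff_quad a b), quadExp]
  congr 1
  rw [map_add, map_mul, map_mul, map_pow, flow_X, flow_C_of_eq_zero d hb, flow_C d (by rw [ha, hc]),
    ha, map_add]
  ring

theorem formalExp_gaussShift (δ c : A) : formalExp (gaussShift δ c) =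
    quadExp (Polynomial.C (δ * c) * Polynomial.X)
      (-Polynomial.C (algebraMap ℚ A (1 / 2) * (δ * c ^ 2))) := by
  rw [gaussShift, quadExp, map_neg, neg_mul, sub_eq_add_neg]

/-- Coefficients of s eˢ/(eˢ - 1) = s/(eˢ - 1) + s. -/
theorem sum_bernoulli_div_factorial (m : ℕ) :
    ∑ q ∈ Finset.HasAntidiagonal.antidiagonal m, bernoulli q.1 / (q.1 ! : ℚ) / (q.2 ! : ℚ) =
      bernoulli m / (m ! : ℚ) + if m = 1 then 1 else 0 := by
  have h := congrArg (coeff m) (bernoulliPowerSeries_mul_exp_sub_one ℚ)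
  rw [mul_sub, mul_one, map_sub, sub_eq_iff_eq_add, coeff_mul, coeff_X, add_comm] at h
  simp only [bernoulliPowerSeries, coeff_mk, coeff_exp] at h
  simp only [Algebra.algebraMap_self, RingHom.id_apply] at h
  rw [← h]
  refine Finset.sum_congr rfl fun q _ => ?_
  rw [mul_one_div]

theorem iterate_derivation_pow (d : Derivation ℚ A A) {x : A} (hx : d x = 1) {b : A} (hb : d b = 0)
    (r : ℚ) (l j : ℕ) : d^[j] (algebraMap ℚ A r * x ^ l * b) =
      algebraMap ℚ A (r * l.descFactorial j) * x ^ (l - j) * b := by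
  induction j with
  | zero => simp
  | succ j ih =>
    rw [Function.iterate_succ_apply', ih, Derivation.leibniz, Derivation.leibniz,
      Derivation.leibniz_pow, Derivation.map_algebraMap, hb, hx, Nat.descFactorial_succ]
    simp only [smul_eq_mul, nsmul_eq_mul, mul_zero, zero_add, add_zero, mul_one]
    rw [Nat.sub_sub, show r * ((l - j) * l.descFactorial j : ℕ) =
      r * l.descFactorial j * ((l - j : ℕ) : ℚ) by push_cast; ring, map_mul _ (r * _), map_natCast]
    ring

/-- Reindexing of the Taylor expansion of the exponent of `ψ` at a shifted argument. -/
theorem sum_weightPairs_shift (c : ℕ → ℚ) (x : A) (f : ℕ → A) {n : ℕ} (hn : n ≠ 0) :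
    ∑ p ∈ Finset.HasAntidiagonal.antidiagonal n, ∑ q ∈ weightPairs (p.1 + 2),
      algebraMap ℚ A (1 / (p.2 ! : ℚ)) *
        (algebraMap ℚ A (c q.1 / (q.2 ! : ℚ) * q.2.descFactorial p.2) * x ^ (q.2 - p.2) *
          f (q.1 + q.2)) =
    ∑ q ∈ weightPairs (n + 2),
      algebraMap ℚ A ((∑ s ∈ Finset.HasAntidiagonal.antidiagonal q.1, c s.1 / (s.2 ! : ℚ)) / (q.2 ! : ℚ)) *
        x ^ q.2 * f (q.1 + q.2) := by
  have hR : ∀ q : ℕ × ℕ,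
      algebraMap ℚ A ((∑ s ∈ Finset.HasAntidiagonal.antidiagonal q.1, c s.1 / (s.2 ! : ℚ)) / (q.2 ! : ℚ)) *
        x ^ q.2 * f (q.1 + q.2) =
      ∑ s ∈ Finset.HasAntidiagonal.antidiagonal q.1,
        algebraMap ℚ A (c s.1 / ((s.2 ! : ℚ) * (q.2 ! : ℚ))) * x ^ q.2 * f (q.1 + q.2) := fun q => by
    rw [Finset.sum_div, map_sum, Finset.sum_mul, Finset.sum_mul]
    simp only [div_div]
  simp only [hR]
  rw [Finset.sum_sigma', Finset.sum_sigma']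
  rw [← Finset.sum_filter_of_ne (p := fun s : (_ : ℕ × ℕ) × (ℕ × ℕ) => s.1.2 ≤ s.2.2)
    fun s _ hs => by
      by_contra hlt
      refine hs ?_
      rw [Nat.descFactorial_eq_zero_iff_lt.mpr (not_le.mp hlt)]
      simp]
  -- The Taylor term of order j sends (k, ℓ) to (k + j, ℓ - j). This keeps k + ℓ, hence the order of
  -- Li, and raises the weight by j.
  refine Finset.sum_nbij' (fun s => ⟨(s.2.1 + s.1.2, s.2.2 - s.1.2), (s.2.1, s.1.2)⟩)
    (fun s => ⟨(n - s.2.2, s.2.2), (s.2.1, s.1.2 + s.2.2)⟩) ?_ ?_ ?_ ?_ ?_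
  · rintro ⟨⟨i, j⟩, ⟨k, l⟩⟩ hs
    simp only [Finset.mem_filter, Finset.mem_sigma, Finset.HasAntidiagonal.mem_antidiagonal,
      mem_weightPairs, and_true] at hs ⊢
    omega
  · rintro ⟨⟨m, l⟩, ⟨k, j⟩⟩ hs
    simp only [Finset.mem_filter, Finset.mem_sigma, Finset.HasAntidiagonal.mem_antidiagonal,
      mem_weightPairs] at hs ⊢
    omega
  · rintro ⟨⟨i, j⟩, ⟨k, l⟩⟩ hs
    simp only [Finset.mem_filter, Finset.mem_sigma, Finset.HasAntidiagonal.mem_antidiagonal,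
      mem_weightPairs] at hs
    obtain ⟨l, rfl⟩ := Nat.exists_eq_add_of_le hs.2
    obtain ⟨⟨rfl, _⟩, _⟩ := hs
    simp [add_comm]
  · rintro ⟨⟨m, l⟩, ⟨k, j⟩⟩ hs
    simp only [Finset.mem_sigma, Finset.HasAntidiagonal.mem_antidiagonal, mem_weightPairs] at hs
    obtain ⟨_, rfl⟩ := hs
    simp
  · rintro ⟨⟨i, j⟩, ⟨k, l⟩⟩ hs
    simp only [Finset.mem_filter] at hs
    obtain ⟨l, rfl⟩ := Nat.exists_eq_add_of_le hs.2
    dsimp only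
    rw [Nat.add_sub_cancel_left, add_assoc, ← mul_assoc, ← mul_assoc, ← map_mul]
    congr 3
    have h := Nat.factorial_mul_descFactorial (Nat.le_add_right j l)
    rw [Nat.add_sub_cancel_left] at h
    rw [← h]
    have : ((j + l).descFactorial j : ℚ) ≠ 0 := by
      exact_mod_cast (Nat.pos_of_ne_zero fun h0 => by
        rw [Nat.descFactorial_eq_zero_iff_lt] at h0; omega).ne'
    push_cast
    field_simp

/-- The shift x → x + t replaces xt by xt + ħ, so it multiplies the series ∑ B_k ħ^k/k! by e^ħ. This
changes only the coefficient with k = 1, which yields log(1 - z e^{xt}) up to the terms of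
nonpositive order in t. The quadratic terms come from -x² Li₀(z)/2, which the exponent of ψ omits.
-/
theorem flow_psiE (d : Derivation ℚ A A) {p x : A} (hx : d x = 1) (hp : d p = 0) :
    flow d (psiE p x) = psiE p x + shiftLog p x +
      (C (p * x) * X + C (algebraMap ℚ A (1 / 2) * p) * X ^ 2) := by
  have hli : ∀ m, d (li p m) = 0 := fun m => by
    rw [derivation_li d (ε := 0) (by rw [hp, zero_mul]), zero_mul]
  ext n
  rcases eq_or_ne n 0 with rfl | hn
  · simp [constantCoeff_shiftLog]
  -- Order zero is rewritten as the weight-2 sum plus a compensating term, so that the reindexing is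
  -- uniform. For the pair (1, 0) the truncated subtraction 1 - 2 = 0 puts Li₀ where Li₁ would
  -- stand; d kills both this term and its compensation.
  have hE : ∀ i, coeff i (psiE p x) = -∑ q ∈ weightPairs (i + 2),
        algebraMap ℚ A (bernoulli q.1 / ((q.2 ! : ℚ) * (q.1 ! : ℚ))) * x ^ q.2 *
          li p (q.1 + q.2 - 2) + if i = 0 then algebraMap ℚ A (1 / 2) * (x ^ 2 * p - p) else 0 := by
    intro i
    rw [psiE, coeff_mk]
    split_ifs with hi
    · subst hi
      have : weightPairs (0 + 2) = {(1, 0), (0, 2)} := by decide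
      rw [this, Finset.sum_pair (by decide)]
      have e1 : bernoulli 1 / ((0 ! : ℚ) * (1 ! : ℚ)) = -(1 / 2) := by
        norm_num [bernoulli_one, Nat.factorial]
      have e2 : bernoulli 0 / ((2 ! : ℚ) * (0 ! : ℚ)) = 1 / 2 := by
        norm_num [bernoulli_zero, Nat.factorial]
      dsimp only
      rw [e1, e2, map_neg, show 1 + 0 - 2 = 0 from rfl, li_zero]
      ring
    · rw [add_zero]
  have hterm : ∀ i j, d^[j] (∑ q ∈ weightPairs (i + 2),
        algebraMap ℚ A (bernoulli q.1 / ((q.2 ! : ℚ) * (q.1 ! : ℚ))) * x ^ q.2 *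
          li p (q.1 + q.2 - 2)) = ∑ q ∈ weightPairs (i + 2),
        algebraMap ℚ A (bernoulli q.1 / (q.1 ! : ℚ) / (q.2 ! : ℚ) * q.2.descFactorial j) *
          x ^ (q.2 - j) * li p (q.1 + q.2 - 2) := by
    intro i j
    have : ∀ s : Finset (ℕ × ℕ), ∀ g : ℕ × ℕ → A, d^[j] (∑ q ∈ s, g q) = ∑ q ∈ s, d^[j] (g q) := by
      intro s g
      induction j with
      | zero => rfl
      | succ j ih => simp only [Function.iterate_succ_apply', ih, map_sum]
    rw [this]
    refine Finset.sum_congr rfl fun q _ => ?_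
    rw [iterate_derivation_pow d hx (hli _), div_div, mul_comm (q.1 ! : ℚ)]
  have hneg : ∀ (j : ℕ) (a b : A), d^[j] (-a + b) = -d^[j] a + d^[j] b := by
    intro j a b
    rw [iterate_map_add, iterate_map_neg]
  have hhalf : algebraMap ℚ A (1 / 2) * 2 = 1 := by
    rw [show (2 : A) = algebraMap ℚ A 2 from (map_ofNat _ 2).symm, ← map_mul]
    norm_num
  have hd1 : d (algebraMap ℚ A (1 / 2) * (x ^ 2 * p - p)) = x * p := by
    rw [Derivation.leibniz, Derivation.map_algebraMap, map_sub, Derivation.leibniz,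
      Derivation.leibniz_pow, hp, hx]
    simp only [smul_eq_mul, nsmul_eq_mul]
    push_cast
    linear_combination (x * p) * hhalf
  have hd2 : d (x * p) = p := by
    rw [Derivation.leibniz, hx, hp]
    simp
  have hquad : ∑ s ∈ Finset.HasAntidiagonal.antidiagonal n, algebraMap ℚ A (1 / (s.2 ! : ℚ)) *
      d^[s.2] (if s.1 = 0 then algebraMap ℚ A (1 / 2) * (x ^ 2 * p - p) else 0) =
      coeff n (C (p * x) * X + C (algebraMap ℚ A (1 / 2) * p) * X ^ 2) := by
    rw [Finset.sum_eq_single (0, n)]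
    · dsimp only
      rw [if_pos rfl, map_add, coeff_C_mul, coeff_C_mul, coeff_X, coeff_X_pow]
      rcases n with _ | _ | _ | n
      · exact absurd rfl hn
      · simp only [zero_add, Function.iterate_one, hd1]
        simp [mul_comm]
      · simp only [zero_add, Function.iterate_succ_apply, Function.iterate_zero, id, hd1, hd2]
        simp [Nat.factorial]
      · simp only [Function.iterate_succ_apply, hd1, hd2, hp, iterate_map_zero]
        simp
    · intro s hs hne
      rw [Finset.HasAntidiagonal.mem_antidiagonal] at hs
      rw [if_neg, iterate_map_zero, mul_zero]
      intro h0
      exact hne (Prod.ext h0 (by dsimp only; omega))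
    · intro h
      exact absurd (by rw [Finset.HasAntidiagonal.mem_antidiagonal, zero_add]) h
  have hmain : ∑ q ∈ weightPairs (n + 2), algebraMap ℚ A
        ((bernoulli q.1 / (q.1 ! : ℚ) + if q.1 = 1 then 1 else 0) / (q.2 ! : ℚ)) * x ^ q.2 *
          li p (q.1 + q.2 - 2) =
      ∑ q ∈ weightPairs (n + 2), algebraMap ℚ A
        (bernoulli q.1 / ((q.2 ! : ℚ) * (q.1 ! : ℚ))) * x ^ q.2 * li p (q.1 + q.2 - 2) +
      algebraMap ℚ A (1 / (n ! : ℚ)) * x ^ n * li p (n - 1) := by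
    simp only [add_div, map_add, add_mul, Finset.sum_add_distrib, div_div]
    congr 1
    · refine Finset.sum_congr rfl fun q _ => ?_
      rw [mul_comm (q.1 ! : ℚ)]
    · rw [Finset.sum_eq_single (1, n)]
      · dsimp only
        rw [if_pos rfl, show 1 + n - 2 = n - 1 by omega]
      · intro q hq hne
        rw [mem_weightPairs] at hq
        rw [if_neg, zero_div, map_zero, zero_mul, zero_mul]
        intro h0
        exact hne (Prod.ext h0 (by dsimp only; omega))
      · intro h
        exact absurd (mem_weightPairs.mpr (by dsimp only; omega)) h
  rw [coeff_flow]
  simp only [hE, hneg, hterm, mul_add, mul_neg, Finset.sum_add_distrib, Finset.sum_neg_distrib,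
    Finset.mul_sum]
  rw [sum_weightPairs_shift (fun k => bernoulli k / (k ! : ℚ)) x (fun m => li p (m - 2)) hn]
  simp only [sum_bernoulli_div_factorial]
  rw [hquad, hmain, map_add (coeff n) (psiE p x + shiftLog p x),
    map_add (coeff n) (psiE p x), hE, if_neg hn, shiftLog, coeff_mk,
    if_neg hn]
  ring

theorem flow_psiP (d : Derivation ℚ A A) {p x : A} (hx : d x = 1) (hp : d p = 0) :
    flow d (psiP p x) =
      psiP p x * shiftFactor p x * quadExp (p * x) (algebraMap ℚ A (1 / 2) * p) := by
  have h1 := constantCoeff_psiE p x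
  have h2 := constantCoeff_shiftLog p x
  rw [psiP, flow_formalExp d h1, flow_psiE d hx hp,
    formalExp_add (by rw [map_add, h1, h2, add_zero]) (constantCoeff_quad _ _),
    formalExp_add h1 h2, formalExp_shiftLog, quadExp]

/-- Here ε is the logarithmic derivative of the shape z. The factor t allows `psiDx_eq` to trade z∂z
for ∂x, leaving an explicit quadratic term. -/
theorem psiDx_spec (d : Derivation ℚ A A) {p x ε : A} (h : d p = ε * (p + p ^ 2)) :
    X * coeffDer d (psiP p x) = ((X * C (d x) + C ε) * psiDx p x +
      X * C (ε * (algebraMap ℚ A (1 / 2) * (x ^ 2 * (p + p ^ 2) - p)))) * psiP p x := by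
  rw [psiP, coeffDer_formalExp d (constantCoeff_psiE p x), coeffDer_psiE_eq d h x]
  simp only [map_mul C ε]
  linear_combination (-C ε * formalExp (psiE p x)) * psiDx_eq p x

theorem coeffDer_psiP (d : Derivation ℚ A A) {p x : A} (h : d p = 0) :
    coeffDer d (psiP p x) = C (d x) * psiDx p x * psiP p x := by
  rw [psiP, coeffDer_formalExp d (constantCoeff_psiE p x),
    coeffDer_psiE_eq d (ε := 0) (by rw [h, zero_mul]) x, map_zero, zero_mul, add_zero]

end Shift

/-! ### The pentagon data and the rational identities between its shapes. -/

section Pentagon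

/-- The data entering the pentagon identity over an arbitrary ring, in terms of `u = z₁⁻¹` and
`v = z₂⁻¹`. -/
structure PentagonData (A : Type*) [CommRing A] where
  /-- The inverse of `z₁`. -/
  u : A
  /-- The inverse of `z₂`. -/
  v : A
  /-- The inverse of `1 - u`. -/
  i₁ : A
  /-- The inverse of `1 - v`. -/
  i₂ : A
  /-- The inverse of `1 - u - v`. -/
  i₀ : A
  /-- The first argument. -/
  x : A
  /-- The second argument. -/
  y : A
  hi₁ : i₁ * (1 - u) = 1
  hi₂ : i₂ * (1 - v) = 1
  hi₀ : i₀ * (1 - u - v) = 1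

namespace PentagonData

variable {A B : Type*} [CommRing A] [Algebra ℚ A] [CommRing B] [Algebra ℚ B] (S : PentagonData A)

omit [Algebra ℚ A] [Algebra ℚ B]

/-- `Li₀(z₀)`. -/
def p₀ : A := -((1 - S.u - S.v) * S.i₁ * S.i₂)
/-- `Li₀(z₁ / z₀)`. -/
def p₁ : A := -(S.v * S.i₁)
/-- `Li₀(z₂ / z₀)`. -/
def p₂ : A := -(S.u * S.i₂)
/-- The quadratic form of the Gaussian integral. -/
def δ : A := (1 - S.u - S.v) ^ 2 * S.i₁ * S.i₂
/-- The inverse of `δ`. -/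
def μ : A := (1 - S.u) * (1 - S.v) * S.i₀ ^ 2
/-- The linear form `(x z₂ + y z₁) / z₀`. -/
def sh : A := -(S.u * S.i₀) * S.x + -(S.v * S.i₀) * S.y

/-- The argument at the shape `z₁ / z₀`. -/
def X₁ : Polynomial A := -Polynomial.X + Polynomial.C (-S.y + S.sh)
/-- The argument at the shape `z₀`. -/
def X₀ : Polynomial A := Polynomial.X + Polynomial.C (S.x + S.y - S.sh)
/-- The argument at the shape `z₂ / z₀`. -/
def X₂ : Polynomial A := -Polynomial.X + Polynomial.C (-S.x + S.sh)

theorem δ_mul_μ : S.δ * S.μ = 1 := by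
  have h1 := S.hi₁; have h2 := S.hi₂; have h0 := S.hi₀
  simp only [δ, μ]
  grind

theorem δ_mul_i₀ : S.δ * S.i₀ = -S.p₀ := by
  have h1 := S.hi₁; have h2 := S.hi₂; have h0 := S.hi₀
  simp only [δ, p₀]
  grind

theorem p₀_add : S.p₀ - S.δ * S.i₀ ^ 2 = -S.i₁ - S.i₂ := by
  have h1 := S.hi₁; have h2 := S.hi₂; have h0 := S.hi₀
  simp only [δ, p₀]
  grind

theorem p₀_mul_sh : S.p₀ * (S.x + S.y - S.sh) = -S.i₁ * S.x + -S.i₂ * S.y := by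
  have h1 := S.hi₁; have h2 := S.hi₂; have h0 := S.hi₀
  simp only [sh, p₀]
  grind

theorem δ_eq : S.δ = 2 + S.p₁ + S.p₀ + S.p₂ := by
  have h1 := S.hi₁; have h2 := S.hi₂; have h0 := S.hi₀
  simp only [δ, p₀, p₁, p₂]
  grind

/-- Together with `δ_eq` this gives (p₀ + 2)X₀ - p₁X₁ - p₂X₂ = δw + x + y, which matches the linear
exponents in `gauss_telescope`. -/
theorem saddle : (S.p₀ + 2) * (S.x + S.y - S.sh) - S.p₁ * (-S.y + S.sh) - S.p₂ * (-S.x + S.sh) =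
    S.x + S.y := by
  have h1 := S.hi₁; have h2 := S.hi₂; have h0 := S.hi₀
  simp only [sh, p₀, p₁, p₂]
  grind

end PentagonData
end Pentagon

/-! ### Translating w in the integrand. -/

section PentagonShift

variable {A B : Type*} [CommRing A] [Algebra ℚ A] [CommRing B] [Algebra ℚ B]

theorem flow_neg_flow (d : Derivation ℚ A A) (f : PowerSeries A) : flow (-d) (flow d f) = f := by
  rw [← flow_add_apply (-d) d (fun a => by simp), neg_add_cancel]
  exact flow_eq_self _ (by ext n; simp)

theorem flow_shiftFactor_psiP (d : Derivation ℚ A A) {p x : A} (hx : d x = -1) (hp : d p = 0) :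
    flow d (psiP p x * shiftFactor p x * quadExp (p * x) (algebraMap ℚ A (1 / 2) * p)) =
      psiP p x := by
  rw [← flow_psiP (-d) (by simp [hx]) (by simp [hp])]
  simpa using flow_neg_flow (-d) (psiP p x)

theorem polyDer_derivative (d : Derivation ℚ A A) (f : Polynomial A) :
    polyDer d (Polynomial.derivative f) = Polynomial.derivative (polyDer d f) := by
  ext n
  rw [coeff_polyDer, Polynomial.coeff_derivative, Polynomial.coeff_derivative, coeff_polyDer,
    Derivation.leibniz]
  simp [mul_comm]

/-- Lets w move along with x and y; the compensating translation is absorbed by `gauss_flow_varDer`.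
-/
theorem flow_polyDer (d : Derivation ℚ A A) {c : A} (hc : d c = 0) (f : PowerSeries (Polynomial A)) :
    flow (polyDer d) f = flow (Polynomial.C (-c) • varDer A)
      (flow (polyDer d + Polynomial.C c • varDer A) f) := by
  rw [← flow_add_apply]
  · congr 2
    ext p
    simp
  · intro a
    simp only [Derivation.add_apply, Derivation.smul_apply, varDer_apply, smul_eq_mul,
      Polynomial.derivative_add, Polynomial.derivative_C_mul, Derivation.leibniz, polyDer_C,
      polyDer_derivative, map_neg, hc]
    simp

/-- A derivation killing `x` kills the inverse of `x`. -/
theorem derivation_inverse_eq_zero (d : Derivation ℚ A A) {i x : A} (h : i * x = 1)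
    (hx : d x = 0) : d i = 0 := by
  have h1 := congrArg d h
  rw [Derivation.leibniz, hx, Derivation.map_one_eq_zero] at h1
  simp only [smul_eq_mul, mul_zero, zero_add] at h1
  linear_combination i * h1 - d i * h

namespace PentagonData

variable (S : PentagonData A)

/-- The integrand of the pentagon identity. -/
def integrand : PowerSeries (Polynomial A) :=
  psiP (Polynomial.C S.p₁) S.X₁ * psiP (Polynomial.C S.p₀) S.X₀ * psiP (Polynomial.C S.p₂) S.X₂

/-- The left hand side of the pentagon identity. -/
def lhs : PowerSeries A := psiP (-S.i₁) S.x * psiP (-S.i₂) S.y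

/-- The right hand side of the pentagon identity. -/
def rhs : PowerSeries A := quadExp 0 (algebraMap ℚ A (-1 / 24)) * gauss S.μ S.integrand

/-- The multiplier of both sides under the shift of `x` and `y` by `t`. -/
def multiplier : PowerSeries A :=
  shiftFactor (-S.i₁) S.x * shiftFactor (-S.i₂) S.y *
    quadExp (-S.i₁ * S.x + -S.i₂ * S.y) (algebraMap ℚ A (1 / 2) * (-S.i₁ - S.i₂))

theorem map_shiftFactor (r : A →+* B) (p a : A) :
    map r (shiftFactor p a) = shiftFactor (r p) (r a) := by
  rw [shiftFactor, map_sub, map_mul, map_C, map_C, ex_eq_quadExp, map_quadExp, map_zero,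
    ← ex_eq_quadExp, shiftFactor, map_add, map_one]

/-- The combination of shift factors that integrates to zero. -/
theorem gauss_telescope : gauss S.μ (S.integrand *
    (shiftFactor (Polynomial.C S.p₁) S.X₁ * shiftFactor (Polynomial.C S.p₂) S.X₂ * ex S.X₀ -
      shiftFactor (Polynomial.C S.p₀) S.X₀ * ex (Polynomial.C (S.x + S.y) - S.X₀))) = 0 := by
  set c : A →+* Polynomial A := Polynomial.C with hc
  set half : Polynomial A := algebraMap ℚ (Polynomial A) (1 / 2) with hhalf
  have hh : half * 2 = 1 := by
    rw [hhalf, show (2 : Polynomial A) = algebraMap ℚ _ 2 from (map_ofNat _ 2).symm, ← map_mul]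
    norm_num
  -- Translation of w by -t raises X₁ and X₂ by t and lowers X₀ by t.
  set d : Derivation ℚ (Polynomial A) (Polynomial A) := c (-1) • varDer A with hd
  have dc : ∀ a, d (c a) = 0 := fun a => by
    simp [hd, hc]
  have dX₁ : d S.X₁ = 1 := by simp [hd, hc, X₁]
  have dX₂ : d S.X₂ = 1 := by simp [hd, hc, X₂]
  have dX₀ : d S.X₀ = -1 := by simp [hd, hc, X₀]
  have hδ : c S.δ = 2 + c S.p₁ + c S.p₀ + c S.p₂ := by
    rw [S.δ_eq]
    simp only [map_add, map_ofNat]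
  have hs := congrArg c S.saddle
  simp only [map_add, map_sub, map_mul, map_ofNat, map_neg] at hs
  have eX₁ : S.X₁ = -Polynomial.X + (-c S.y + c S.sh) := by simp only [X₁, map_add, map_neg, hc]
  have eX₂ : S.X₂ = -Polynomial.X + (-c S.x + c S.sh) := by simp only [X₂, map_add, map_neg, hc]
  have eX₀ : S.X₀ = Polynomial.X + (c S.x + c S.y - c S.sh) := by
    simp only [X₀, map_add, map_sub, hc]
  -- The auxiliary factor exp(αt + βt²) is fixed by requiring that, after the translation, the
  -- exponentials combine to e^{X₀t}. Those on the other side then combine to e^{(x+y-X₀)t}, by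
  -- `saddle` and `δ_eq`.
  set α : Polynomial A := S.X₀ - c S.p₁ * S.X₁ - c S.p₂ * S.X₂ with hα
  set β : Polynomial A := 1 + half * (c S.p₁ + c S.p₂) with hβ
  have dα : d α = -1 - c S.p₁ - c S.p₂ := by
    rw [hα, map_sub, map_sub, Derivation.leibniz, Derivation.leibniz, dX₁, dX₂, dX₀, dc, dc]
    simp
  have dβ : d β = 0 := by
    rw [hβ, hhalf, map_add, Derivation.leibniz, Derivation.map_one_eq_zero, map_add, dc, dc,
      Derivation.map_algebraMap]
    simp only [add_zero, smul_zero]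
  have key := gauss_flow_varDer S.δ_mul_μ (-1) (psiP (c S.p₁) S.X₁ * psiP (c S.p₂) S.X₂ *
    (psiP (c S.p₀) S.X₀ * shiftFactor (c S.p₀) S.X₀ * quadExp (c S.p₀ * S.X₀) (half * c S.p₀)) *
    quadExp α β)
  rw [← hd, map_mul (flow d), map_mul (flow d), map_mul (flow d),
    flow_psiP d dX₁ (dc _),
    flow_psiP d dX₂ (dc _), flow_shiftFactor_psiP d dX₀ (dc _),
    flow_quadExp d dα (by rw [map_sub, map_sub, map_neg, dc, dc, Derivation.map_one_eq_zero]; simp)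
      dβ, formalExp_gaussShift, ← hc, ← hhalf] at key
  have e1 : ex S.X₀ = quadExp (c S.p₁ * S.X₁) (half * c S.p₁) *
      quadExp (c S.p₂ * S.X₂) (half * c S.p₂) * quadExp α (β + (-1 - c S.p₁ - c S.p₂)) := by
    rw [ex_eq_quadExp, ← quadExp_add, ← quadExp_add]
    congr 1
    · rw [hα]
      ring
    · rw [hβ]
      linear_combination (-(c S.p₁ + c S.p₂)) * hh
  have e2 : ex (c (S.x + S.y) - S.X₀) = quadExp (c S.p₀ * S.X₀) (half * c S.p₀) * quadExp α β *
      quadExp (c (S.δ * -1) * Polynomial.X)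
        (-c (algebraMap ℚ A (1 / 2) * (S.δ * (-1) ^ 2))) := by
    rw [ex_eq_quadExp, ← quadExp_add, ← quadExp_add]
    have hch : c (algebraMap ℚ A (1 / 2)) = half := rfl
    congr 1
    · rw [hα, map_mul, map_neg, map_one, hδ, map_add]
      simp only [eX₁, eX₂, eX₀]
      linear_combination -hs
    · rw [hβ, map_mul, map_mul, map_pow, map_neg, map_one, hch, hδ]
      linear_combination hh
  rw [mul_sub, map_sub, sub_eq_zero, integrand, e1, e2]
  refine Eq.trans (congrArg (gauss S.μ) ?_) (key.trans (congrArg (gauss S.μ) ?_))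
  · ring
  · ring

/-- Since X₁ + X₀ = x and X₂ + X₀ = y, the factor at z₀ is a rational expression in the e^{X_i t}.
It equals the product of the factors at z₁ and z₂, which is free of w, plus i₀ times the combination
of `gauss_telescope`. -/
theorem gauss_shiftFactor : gauss S.μ (S.integrand * shiftFactor (Polynomial.C S.p₀) S.X₀) =
    shiftFactor (-S.i₁) S.x * shiftFactor (-S.i₂) S.y * gauss S.μ S.integrand := by
  set c : A →+* Polynomial A := Polynomial.C with hc
  have h1 := congrArg c S.hi₁
  have h2 := congrArg c S.hi₂
  have h0 := congrArg c S.hi₀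
  simp only [map_mul, map_sub, map_one] at h1 h2 h0
  have hx : ex S.X₁ * ex S.X₀ = ex (c S.x) := by
    rw [← ex_add]
    congr 1
    simp only [X₁, X₀, ← hc, map_add, map_sub, map_neg]
    ring
  have hy : ex S.X₂ * ex S.X₀ = ex (c S.y) := by
    rw [← ex_add]
    congr 1
    simp only [X₂, X₀, ← hc, map_add, map_sub, map_neg]
    ring
  have hxy : ex (c (S.x + S.y) - S.X₀) * ex S.X₀ = ex (c S.x) * ex (c S.y) := by
    rw [← ex_add, ← ex_add]
    congr 1
    rw [map_add]
    ring
  have hxy' : ex (c (S.x + S.y) - S.X₀) = ex (c S.x) * ex S.X₂ := by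
    rw [← ex_add]
    congr 1
    simp only [X₂, X₀, ← hc, map_add, map_sub, map_neg]
    ring
  have hid : shiftFactor (c S.p₀) S.X₀ =
      map c (shiftFactor (-S.i₁) S.x * shiftFactor (-S.i₂) S.y) +
      C (c S.i₀) * (shiftFactor (c S.p₁) S.X₁ * shiftFactor (c S.p₂) S.X₂ * ex S.X₀ -
      shiftFactor (c S.p₀) S.X₀ * ex (c (S.x + S.y) - S.X₀)) := by
    have g1 := congrArg (C (R := Polynomial A)) h1
    have g2 := congrArg (C (R := Polynomial A)) h2
    have g0 := congrArg (C (R := Polynomial A)) h0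
    rw [map_mul, map_shiftFactor, map_shiftFactor, hxy']
    simp only [shiftFactor, p₀, p₁, p₂, map_mul, map_sub, map_add, map_neg, map_one] at g1 g2 g0 ⊢
    rw [← hx, ← hy]
    generalize ex S.X₀ = e0
    generalize ex S.X₁ = e1
    generalize ex S.X₂ = e2
    generalize C (c S.u) = u at *
    generalize C (c S.v) = v at *
    generalize C (c S.i₁) = i1 at *
    generalize C (c S.i₂) = i2 at *
    generalize C (c S.i₀) = i0 at *
    clear hx hy hxy hxy' h1 h2 h0
    grind
  have ht := S.gauss_telescope
  rw [← hc] at ht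
  rw [hid, mul_add, map_add, mul_left_comm, gauss_C_mul, ht, mul_zero, add_zero, mul_comm,
    gauss_map_C_mul]

end PentagonData
end PentagonShift

/-! ### The difference equation of both sides, and the Euler equation of the left side. -/

section PentagonEquations

variable {A B : Type*} [CommRing A] [Algebra ℚ A] [CommRing B] [Algebra ℚ B]

theorem flow_quadExp_of_eq_zero (d : Derivation ℚ A A) {a b : A} (ha : d a = 0) (hb : d b = 0) :
    flow d (quadExp a b) = quadExp a b := by
  rw [flow_quadExp d ha (map_zero d) hb, add_zero]

namespace PentagonData

variable (S : PentagonData A)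

theorem flow_lhs (d : Derivation ℚ A A) (hx : d S.x = 1) (hy : d S.y = 1) (hu : d S.u = 0)
    (hv : d S.v = 0) : flow d S.lhs = S.multiplier * S.lhs := by
  have hi₁ : d S.i₁ = 0 := derivation_inverse_eq_zero d S.hi₁ (by simp [hu])
  have hi₂ : d S.i₂ = 0 := derivation_inverse_eq_zero d S.hi₂ (by simp [hv])
  rw [lhs, map_mul, flow_psiP d hx (by rw [map_neg, hi₁, neg_zero]),
    flow_psiP d hy (by rw [map_neg, hi₂, neg_zero]), multiplier, sub_eq_add_neg, mul_add,
    quadExp_add]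
  ring

theorem flow_rhs (d : Derivation ℚ A A) (hx : d S.x = 1) (hy : d S.y = 1) (hu : d S.u = 0)
    (hv : d S.v = 0) : flow d S.rhs = S.multiplier * S.rhs := by
  have hi₁ : d S.i₁ = 0 := derivation_inverse_eq_zero d S.hi₁ (by simp [hu])
  have hi₂ : d S.i₂ = 0 := derivation_inverse_eq_zero d S.hi₂ (by simp [hv])
  have hi₀ : d S.i₀ = 0 := derivation_inverse_eq_zero d S.hi₀ (by simp [hu, hv])
  have hμ : d S.μ = 0 := by simp [μ, Derivation.leibniz, Derivation.leibniz_pow, hu, hv, hi₀]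
  have hp₀ : d S.p₀ = 0 := by simp [p₀, Derivation.leibniz, hu, hv, hi₁, hi₂]
  have hp₁ : d S.p₁ = 0 := by simp [p₁, Derivation.leibniz, hv, hi₁]
  have hp₂ : d S.p₂ = 0 := by simp [p₂, Derivation.leibniz, hu, hi₂]
  have hsh : d S.sh = -(S.u * S.i₀) + -(S.v * S.i₀) := by
    simp [sh, Derivation.leibniz, hu, hv, hi₀, hx, hy]
  have h0 := S.hi₀
  -- The speed -i₀ of w is chosen so that X₁ and X₂ stay fixed and X₀ moves by t; only the factor at
  -- z₀ then changes.
  set e : Derivation ℚ (Polynomial A) (Polynomial A) :=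
    polyDer d + Polynomial.C (-S.i₀) • varDer A with he
  have hc : ∀ a, d a = 0 → e (Polynomial.C a) = 0 := fun a ha => by simp [he, ha]
  have eX₁ : e S.X₁ = 0 := by
    have : e S.X₁ = Polynomial.C (-1 + d S.sh + S.i₀) := by simp [he, X₁, hy]
    rw [this, hsh, show -1 + (-(S.u * S.i₀) + -(S.v * S.i₀)) + S.i₀ = 0 by linear_combination h0,
      map_zero]
  have eX₂ : e S.X₂ = 0 := by
    have : e S.X₂ = Polynomial.C (-1 + d S.sh + S.i₀) := by simp [he, X₂, hx]
    rw [this, hsh, show -1 + (-(S.u * S.i₀) + -(S.v * S.i₀)) + S.i₀ = 0 by linear_combination h0,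
      map_zero]
  have eX₀ : e S.X₀ = 1 := by
    have : e S.X₀ = Polynomial.C (1 + 1 - d S.sh - S.i₀) := by
      simp [he, X₀, hx, hy]
      ring
    rw [this, hsh, show 1 + 1 - (-(S.u * S.i₀) + -(S.v * S.i₀)) - S.i₀ = 1 by
      linear_combination -h0, map_one]
  have hI : flow e S.integrand = S.integrand * shiftFactor (Polynomial.C S.p₀) S.X₀ *
      quadExp (Polynomial.C S.p₀ * S.X₀) (algebraMap ℚ _ (1 / 2) * Polynomial.C S.p₀) := by
    rw [integrand, map_mul, map_mul, flow_psiP e eX₀ (hc _ hp₀),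
      flow_eq_self e (by rw [coeffDer_psiP e (hc _ hp₁), eX₁]; simp),
      flow_eq_self e (by rw [coeffDer_psiP e (hc _ hp₂), eX₂]; simp)]
    ring
  -- Because δi₀ = -p₀, the price of translating w back cancels all dependence on w in this
  -- exponential.
  have hQ : quadExp (Polynomial.C S.p₀ * S.X₀)
        (algebraMap ℚ (Polynomial A) (1 / 2) * Polynomial.C S.p₀) *
      formalExp (gaussShift S.δ S.i₀) =
      map Polynomial.C (quadExp (-S.i₁ * S.x + -S.i₂ * S.y)
        (algebraMap ℚ A (1 / 2) * (-S.i₁ - S.i₂))) := by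
    rw [formalExp_gaussShift, ← quadExp_add, map_quadExp, S.δ_mul_i₀, ← S.p₀_mul_sh, ← S.p₀_add, X₀]
    have hch : algebraMap ℚ (Polynomial A) (1 / 2) = Polynomial.C (algebraMap ℚ A (1 / 2)) := rfl
    congr 1
    · simp only [map_mul, map_add, map_sub, map_neg]
      ring
    · rw [hch]
      simp only [map_mul, map_sub]
      ring
  rw [rhs, map_mul, flow_quadExp_of_eq_zero d (map_zero d) (Derivation.map_algebraMap _ _),
    flow_gauss d hμ, flow_polyDer d (c := -S.i₀) (by rw [map_neg, hi₀, neg_zero]), ← he, hI,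
    neg_neg, gauss_flow_varDer S.δ_mul_μ, mul_assoc _ (quadExp _ _), hQ, mul_comm _ (map _ _),
    gauss_map_C_mul, S.gauss_shiftFactor, multiplier]
  ring

/-- The inhomogeneous term of the Euler equation. -/
def eulerTerm : A := algebraMap ℚ A (1 / 2) *
  ((S.x ^ 2 * (-S.i₁ + S.i₁ ^ 2) + S.i₁) + (S.y ^ 2 * (-S.i₂ + S.i₂ ^ 2) + S.i₂))

/-- The derivative of an inverse. -/
theorem derivation_inverse (d : Derivation ℚ A A) {i x : A} (h : i * x = 1) :
    d i = -(i ^ 2 * d x) := by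
  have h1 := congrArg d h
  rw [Derivation.leibniz, Derivation.map_one_eq_zero] at h1
  simp only [smul_eq_mul] at h1
  linear_combination i * h1 - d i * h

section Euler

variable {S} (d D : Derivation ℚ A A) (hx : d S.x = 1) (hy : d S.y = 1) (hu : d S.u = 0)
  (hv : d S.v = 0) (hDx : D S.x = 0) (hDy : D S.y = 0) (hDu : D S.u = -S.u) (hDv : D S.v = -S.v)

include hx hy hu hv hDx hDy hDu hDv

theorem euler_lhs : X * coeffDer D S.lhs = coeffDer d S.lhs + X * C S.eulerTerm * S.lhs := by
  have hi₁ : d S.i₁ = 0 := derivation_inverse_eq_zero d S.hi₁ (by simp [hu])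
  have hi₂ : d S.i₂ = 0 := derivation_inverse_eq_zero d S.hi₂ (by simp [hv])
  have h1 := S.hi₁
  have h2 := S.hi₂
  have hD₁ : D (-S.i₁) = 1 * (-S.i₁ + (-S.i₁) ^ 2) := by
    rw [map_neg, derivation_inverse D h1, map_sub, hDu, Derivation.map_one_eq_zero]
    linear_combination (-S.i₁) * h1
  have hD₂ : D (-S.i₂) = 1 * (-S.i₂ + (-S.i₂) ^ 2) := by
    rw [map_neg, derivation_inverse D h2, map_sub, hDv, Derivation.map_one_eq_zero]
    linear_combination (-S.i₂) * h2
  have s1 := psiDx_spec D (x := S.x) hD₁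
  have s2 := psiDx_spec D (x := S.y) hD₂
  rw [hDx, map_zero, map_one, one_mul] at s1
  rw [hDy, map_zero, map_one, one_mul] at s2
  rw [lhs, coeffDer_mul, coeffDer_mul, coeffDer_psiP d (by rw [map_neg, hi₂, neg_zero]),
    coeffDer_psiP d (by rw [map_neg, hi₁, neg_zero]), hx, hy, map_one, eulerTerm]
  simp only [map_mul, map_add, map_sub, map_neg, map_pow] at s1 s2 ⊢
  linear_combination psiP (-S.i₁) S.x * s2 + psiP (-S.i₂) S.y * s1

end Euler

end PentagonData
end PentagonEquations

/-! ### The Euler equation of the right side. -/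

section PentagonEuler

variable {A : Type*} [CommRing A] [Algebra ℚ A]

namespace PentagonData

variable (S : PentagonData A)

omit [Algebra ℚ A] in
-- This and the next two identities compare the coefficients of w², w and 1 in the quadratic
-- polynomial of `euler_rhs`, the linear one up to a factor 2.
theorem euler_coeff_two : -S.i₀ * (S.p₁ + S.p₁ ^ 2) + (1 + S.i₀) * (S.p₀ + S.p₀ ^ 2) +
    -S.i₀ * (S.p₂ + S.p₂ ^ 2) =
    (2 * ((S.u + S.v) * S.i₀) - (S.u * S.i₁ + S.v * S.i₂)) * S.δ := by
  have h1 := S.hi₁; have h2 := S.hi₂; have h0 := S.hi₀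
  simp only [p₀, p₁, p₂, δ]
  grind

omit [Algebra ℚ A] in
theorem euler_coeff_one : S.i₀ * (S.p₁ + S.p₁ ^ 2) * (-S.y + S.sh) +
      (1 + S.i₀) * (S.p₀ + S.p₀ ^ 2) * (S.x + S.y - S.sh) +
      S.i₀ * (S.p₂ + S.p₂ ^ 2) * (-S.x + S.sh) =
    (S.u * S.i₀ ^ 2 * S.x + S.v * S.i₀ ^ 2 * S.y) * S.δ := by
  have h1 := S.hi₁; have h2 := S.hi₂; have h0 := S.hi₀
  simp only [p₀, p₁, p₂, δ, sh]
  grind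

omit [Algebra ℚ A] in
theorem euler_coeff_zero : -S.i₀ * ((-S.y + S.sh) ^ 2 * (S.p₁ + S.p₁ ^ 2) - S.p₁) +
      (1 + S.i₀) * ((S.x + S.y - S.sh) ^ 2 * (S.p₀ + S.p₀ ^ 2) - S.p₀) +
      -S.i₀ * ((-S.x + S.sh) ^ 2 * (S.p₂ + S.p₂ ^ 2) - S.p₂) +
      (2 * ((S.u + S.v) * S.i₀) - (S.u * S.i₁ + S.v * S.i₂)) =
    (S.x ^ 2 * (-S.i₁ + S.i₁ ^ 2) + S.i₁) + (S.y ^ 2 * (-S.i₂ + S.i₂ ^ 2) + S.i₂) := by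
  have h1 := S.hi₁; have h2 := S.hi₂; have h0 := S.hi₀
  -- The identity is split by degree in x and y: `c` is the constant part, and `cxx`, `cxy`, `cyy`
  -- belong to x², 2xy and y².
  have c : S.i₀ * S.p₁ - (1 + S.i₀) * S.p₀ + S.i₀ * S.p₂ +
      (2 * ((S.u + S.v) * S.i₀) - (S.u * S.i₁ + S.v * S.i₂)) = S.i₁ + S.i₂ := by
    simp only [p₀, p₁, p₂]
    grind
  have q₁ : S.p₁ + S.p₁ ^ 2 = -(S.v * S.i₁ ^ 2 * (1 - S.u - S.v)) := by
    simp only [p₁]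
    linear_combination S.v * S.i₁ * h1
  have q₂ : S.p₂ + S.p₂ ^ 2 = -(S.u * S.i₂ ^ 2 * (1 - S.u - S.v)) := by
    simp only [p₂]
    linear_combination S.u * S.i₂ * h2
  have q₀ : S.p₀ + S.p₀ ^ 2 = -(S.u * S.v * S.i₁ ^ 2 * S.i₂ ^ 2 * (1 - S.u - S.v)) := by
    simp only [p₀]
    linear_combination (S.i₁ * S.i₂ * (1 - S.u - S.v)) * (S.i₂ * (1 - S.v) * h1 + h2)
  have r₁ : 1 + S.u * S.i₀ = (1 - S.v) * S.i₀ := by linear_combination -h0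
  have r₂ : 1 + S.v * S.i₀ = (1 - S.u) * S.i₀ := by linear_combination -h0
  have r₀ : 1 + S.i₀ = (2 - S.u - S.v) * S.i₀ := by linear_combination -h0
  have e2 : (S.i₂ * (1 - S.v)) ^ 2 = 1 := by rw [h2, one_pow]
  have e1 : (S.i₁ * (1 - S.u)) ^ 2 = 1 := by rw [h1, one_pow]
  have e0 : (S.i₀ * (1 - S.u - S.v)) ^ 3 = 1 := by rw [h0, one_pow]
  have cxx : -S.i₀ * (S.u * S.i₀) ^ 2 * (S.p₁ + S.p₁ ^ 2) +
      (1 + S.i₀) * (1 + S.u * S.i₀) ^ 2 * (S.p₀ + S.p₀ ^ 2) -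
      S.i₀ * (1 + S.u * S.i₀) ^ 2 * (S.p₂ + S.p₂ ^ 2) = -S.i₁ + S.i₁ ^ 2 := by
    have e : S.i₁ ^ 2 * S.u = -S.i₁ + S.i₁ ^ 2 := by linear_combination -S.i₁ * h1
    rw [q₁, q₂, q₀, r₁, r₀, ← e]
    linear_combination (S.i₀ ^ 3 * (1 - S.u - S.v) * S.u *
      (1 - (2 - S.u - S.v) * S.v * S.i₁ ^ 2)) * e2 - (S.i₀ ^ 3 * (1 - S.u - S.v) * S.u) * e1 +
      S.u * S.i₁ ^ 2 * e0
  have cxy : -S.i₀ * (S.u * S.i₀) * (1 + S.v * S.i₀) * (S.p₁ + S.p₁ ^ 2) +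
      (1 + S.i₀) * (1 + S.u * S.i₀) * (1 + S.v * S.i₀) * (S.p₀ + S.p₀ ^ 2) -
      S.i₀ * (1 + S.u * S.i₀) * (S.v * S.i₀) * (S.p₂ + S.p₂ ^ 2) = 0 := by
    rw [q₁, q₂, q₀, r₁, r₂, r₀]
    linear_combination ((1 - S.u - S.v) * S.i₀ ^ 3 * S.u * S.v) *
      ((S.i₁ - (2 - S.u - S.v) * S.i₁ * S.i₂ * (S.i₂ * (1 - S.v)) - S.i₂) * h1 +
        (S.i₂ - (2 - S.u - S.v) * S.i₁ * S.i₂ - S.i₁) * h2)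
  have cyy : -S.i₀ * (1 + S.v * S.i₀) ^ 2 * (S.p₁ + S.p₁ ^ 2) +
      (1 + S.i₀) * (1 + S.v * S.i₀) ^ 2 * (S.p₀ + S.p₀ ^ 2) -
      S.i₀ * (S.v * S.i₀) ^ 2 * (S.p₂ + S.p₂ ^ 2) = -S.i₂ + S.i₂ ^ 2 := by
    have e : S.i₂ ^ 2 * S.v = -S.i₂ + S.i₂ ^ 2 := by linear_combination -S.i₂ * h2
    rw [q₁, q₂, q₀, r₂, r₀, ← e]
    linear_combination (S.i₀ ^ 3 * (1 - S.u - S.v) * S.v *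
      (1 - (2 - S.u - S.v) * S.u * S.i₂ ^ 2)) * e1 - (S.i₀ ^ 3 * (1 - S.u - S.v) * S.v) * e2 +
      S.v * S.i₂ ^ 2 * e0
  rw [sh]
  linear_combination c + S.x ^ 2 * cxx + 2 * S.x * S.y * cxy + S.y ^ 2 * cyy


section Euler

variable {S} (d D : Derivation ℚ A A) (hx : d S.x = 1) (hy : d S.y = 1) (hu : d S.u = 0)
  (hv : d S.v = 0) (hDx : D S.x = 0) (hDy : D S.y = 0) (hDu : D S.u = -S.u) (hDv : D S.v = -S.v)

include hx hy hu hv hDx hDy hDu hDv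

/-- Two coincidences drive this. The logarithmic derivatives of z₁/z₀, z₀, z₂/z₀ under D are -i₀, 1
+ i₀, -i₀, exactly the values of d on X₁, X₀, X₂, so the ∂x-terms from `psiDx_spec` assemble to d.
And D moves X₁, X₀, X₂ by η, -η, η, which is the effect of -η d/dw. -/
theorem euler_integrand : X * coeffDer (polyDer D) S.integrand =
    coeffDer (polyDer d) S.integrand -
      X * C (Polynomial.C (S.u * S.i₀ ^ 2 * S.x + S.v * S.i₀ ^ 2 * S.y)) *
        coeffDer (varDer A) S.integrand +
      X * C (Polynomial.C (algebraMap ℚ A (1 / 2)) *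
        (Polynomial.C (-S.i₀) * (S.X₁ ^ 2 * (Polynomial.C S.p₁ + Polynomial.C S.p₁ ^ 2) -
            Polynomial.C S.p₁) +
          Polynomial.C (1 + S.i₀) * (S.X₀ ^ 2 * (Polynomial.C S.p₀ + Polynomial.C S.p₀ ^ 2) -
            Polynomial.C S.p₀) +
          Polynomial.C (-S.i₀) * (S.X₂ ^ 2 * (Polynomial.C S.p₂ + Polynomial.C S.p₂ ^ 2) -
            Polynomial.C S.p₂))) * S.integrand := by
  have hi₁ : d S.i₁ = 0 := derivation_inverse_eq_zero d S.hi₁ (by simp [hu])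
  have hi₂ : d S.i₂ = 0 := derivation_inverse_eq_zero d S.hi₂ (by simp [hv])
  have hi₀ : d S.i₀ = 0 := derivation_inverse_eq_zero d S.hi₀ (by simp [hu, hv])
  have hp₀ : d S.p₀ = 0 := by simp [p₀, Derivation.leibniz, hu, hv, hi₁, hi₂]
  have hp₁ : d S.p₁ = 0 := by simp [p₁, Derivation.leibniz, hv, hi₁]
  have hp₂ : d S.p₂ = 0 := by simp [p₂, Derivation.leibniz, hu, hi₂]
  have h1 := S.hi₁
  have h2 := S.hi₂
  have h0 := S.hi₀
  have hsh : d S.sh = -(S.u * S.i₀) + -(S.v * S.i₀) := by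
    simp [sh, Derivation.leibniz, hu, hv, hi₀, hx, hy]
  have hD₁ : D S.i₁ = -(S.i₁ ^ 2 * S.u) := by
    rw [derivation_inverse D h1, map_sub, hDu, Derivation.map_one_eq_zero]
    ring
  have hD₂ : D S.i₂ = -(S.i₂ ^ 2 * S.v) := by
    rw [derivation_inverse D h2, map_sub, hDv, Derivation.map_one_eq_zero]
    ring
  have hD₀ : D S.i₀ = -(S.i₀ ^ 2 * (S.u + S.v)) := by
    rw [derivation_inverse D h0, map_sub, map_sub, hDu, hDv, Derivation.map_one_eq_zero]
    ring
  have hDsh : D S.sh = S.u * S.i₀ ^ 2 * S.x + S.v * S.i₀ ^ 2 * S.y := by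
    simp only [sh, map_add, map_neg, Derivation.leibniz, hDu, hDv, hD₀, hDx, hDy, smul_eq_mul]
    linear_combination (-S.i₀ * (S.u * S.x + S.v * S.y)) * h0
  have hDp₁ : D S.p₁ = -S.i₀ * (S.p₁ + S.p₁ ^ 2) := by
    simp only [p₁, map_neg, Derivation.leibniz, hDv, hD₁, smul_eq_mul]
    grind
  have hDp₂ : D S.p₂ = -S.i₀ * (S.p₂ + S.p₂ ^ 2) := by
    simp only [p₂, map_neg, Derivation.leibniz, hDu, hD₂, smul_eq_mul]
    grind
  have hDp₀ : D S.p₀ = (1 + S.i₀) * (S.p₀ + S.p₀ ^ 2) := by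
    simp only [p₀, map_neg, map_sub, Derivation.leibniz, Derivation.map_one_eq_zero, hDu, hDv, hD₁,
      hD₂, smul_eq_mul]
    clear hDp₁ hDp₂ hDsh hsh hD₁ hD₂ hD₀ hp₀ hp₁ hp₂ hi₀ hi₁ hi₂
    grind
  have hC : ∀ {a b : A}, D a = b → polyDer D (Polynomial.C a) = Polynomial.C b := by
    rintro a _ rfl
    exact polyDer_C D a
  have hc : ∀ {a : A}, d a = 0 → polyDer d (Polynomial.C a) = 0 := fun h => by
    rw [polyDer_C, h, map_zero]
  set η := S.u * S.i₀ ^ 2 * S.x + S.v * S.i₀ ^ 2 * S.y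
  have DX₁ : polyDer D S.X₁ = Polynomial.C η := by simp [X₁, hDsh, hDy]
  have DX₂ : polyDer D S.X₂ = Polynomial.C η := by simp [X₂, hDsh, hDx]
  have DX₀ : polyDer D S.X₀ = -Polynomial.C η := by simp [X₀, hDsh, hDx, hDy]
  have dX₁ : polyDer d S.X₁ = Polynomial.C (-S.i₀) := by
    rw [show -S.i₀ = -1 + d S.sh by rw [hsh]; linear_combination -h0]
    simp [X₁, hy]
  have dX₂ : polyDer d S.X₂ = Polynomial.C (-S.i₀) := by
    rw [show -S.i₀ = -1 + d S.sh by rw [hsh]; linear_combination -h0]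
    simp [X₂, hx]
  have dX₀ : polyDer d S.X₀ = Polynomial.C (1 + S.i₀) := by
    rw [show 1 + S.i₀ = 1 + 1 - d S.sh by rw [hsh]; linear_combination h0]
    simp [X₀, hx, hy]
  have vX₁ : varDer A S.X₁ = -1 := by simp [X₁]
  have vX₂ : varDer A S.X₂ = -1 := by simp [X₂]
  have vX₀ : varDer A S.X₀ = 1 := by simp [X₀]
  have hv : ∀ a : A, varDer A (Polynomial.C a) = 0 := fun a => by simp
  have s₁ := psiDx_spec (polyDer D) (x := S.X₁) (p := Polynomial.C S.p₁)
    (ε := Polynomial.C (-S.i₀)) (by simp only [hC hDp₁, map_mul, map_add, map_pow])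
  have s₂ := psiDx_spec (polyDer D) (x := S.X₂) (p := Polynomial.C S.p₂)
    (ε := Polynomial.C (-S.i₀)) (by simp only [hC hDp₂, map_mul, map_add, map_pow])
  have s₀ := psiDx_spec (polyDer D) (x := S.X₀) (p := Polynomial.C S.p₀)
    (ε := Polynomial.C (1 + S.i₀)) (by simp only [hC hDp₀, map_mul, map_add, map_pow])
  have hh : algebraMap ℚ (Polynomial A) (1 / 2) = Polynomial.C (algebraMap ℚ A (1 / 2)) := rfl
  rw [hh] at s₁ s₂ s₀
  rw [DX₁] at s₁
  rw [DX₂] at s₂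
  rw [DX₀] at s₀
  simp only [integrand, coeffDer_mul]
  rw [coeffDer_psiP (polyDer d) (hc hp₁), coeffDer_psiP (polyDer d) (hc hp₂),
    coeffDer_psiP (polyDer d) (hc hp₀), coeffDer_psiP (varDer A) (hv _),
    coeffDer_psiP (varDer A) (hv _), coeffDer_psiP (varDer A) (hv _), dX₁, dX₂, dX₀, vX₁, vX₂, vX₀]
  generalize psiP (Polynomial.C S.p₁) S.X₁ = a₁ at *
  generalize psiP (Polynomial.C S.p₂) S.X₂ = a₂ at *
  generalize psiP (Polynomial.C S.p₀) S.X₀ = a₀ at *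
  simp only [map_mul (C (R := Polynomial A)), map_add (C (R := Polynomial A)),
    map_neg (C (R := Polynomial A)), map_one (C (R := Polynomial A)),
    map_sub (C (R := Polynomial A))] at s₁ s₂ s₀ ⊢
  linear_combination a₀ * a₂ * s₁ + a₀ * a₁ * s₂ + a₁ * a₂ * s₀

/-- The quadratic term of `euler_integrand` is ηδw + ρ(δw² - 1) plus `eulerTerm`. By parts, ηδw
cancels the translation -η d/dw, and ρ(δw² - 1) cancels the term -ρ w d/dw caused by the change of
variance. -/
theorem euler_rhs : X * coeffDer D S.rhs = coeffDer d S.rhs + X * C S.eulerTerm * S.rhs := by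
  have hi₀ : d S.i₀ = 0 := derivation_inverse_eq_zero d S.hi₀ (by simp [hu, hv])
  have hμ : d S.μ = -2 * 0 * S.μ := by
    simp [μ, Derivation.leibniz, Derivation.leibniz_pow, hu, hv, hi₀]
  set h : A := algebraMap ℚ A (1 / 2) with hhdef
  have hh : h * 2 = 1 := by
    rw [hhdef, show (2 : A) = algebraMap ℚ _ 2 from (map_ofNat _ 2).symm, ← map_mul]
    norm_num
  have h1 := S.hi₁
  have h2 := S.hi₂
  have h0 := S.hi₀
  set ρ : A := (S.u + S.v) * S.i₀ - h * (S.u * S.i₁ + S.v * S.i₂) with hρ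
  have hDμ : D S.μ = -2 * ρ * S.μ := by
    have hD₀ : D S.i₀ = -(S.i₀ ^ 2 * (S.u + S.v)) := by
      rw [derivation_inverse D h0, map_sub, map_sub, hDu, hDv, Derivation.map_one_eq_zero]
      ring
    rw [hρ]
    simp only [μ, map_sub, Derivation.leibniz, Derivation.leibniz_pow,
      Derivation.map_one_eq_zero, hDu, hDv, hD₀, smul_eq_mul, nsmul_eq_mul]
    push_cast
    linear_combination (-S.i₀ ^ 2 * (1 - S.u) * (1 - S.v) * (S.u * S.i₁ + S.v * S.i₂)) * hh -
      (S.i₀ ^ 2 * (1 - S.v) * S.u) * h1 - (S.i₀ ^ 2 * (1 - S.u) * S.v) * h2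
  have hE := euler_integrand d D hx hy hu hv hDx hDy hDu hDv
  set η := S.u * S.i₀ ^ 2 * S.x + S.v * S.i₀ ^ 2 * S.y with hη
  set Θ : Polynomial A := Polynomial.C h *
        (Polynomial.C (-S.i₀) * (S.X₁ ^ 2 * (Polynomial.C S.p₁ + Polynomial.C S.p₁ ^ 2) -
            Polynomial.C S.p₁) +
          Polynomial.C (1 + S.i₀) * (S.X₀ ^ 2 * (Polynomial.C S.p₀ + Polynomial.C S.p₀ ^ 2) -
            Polynomial.C S.p₀) +
          Polynomial.C (-S.i₀) * (S.X₂ ^ 2 * (Polynomial.C S.p₂ + Polynomial.C S.p₂ ^ 2) -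
            Polynomial.C S.p₂)) with hΘ
  have hpoly : Θ = Polynomial.C η * (Polynomial.C S.δ * Polynomial.X) +
      Polynomial.C ρ * (Polynomial.C S.δ * Polynomial.X ^ 2 - 1) + Polynomial.C S.eulerTerm := by
    have c2 := congrArg Polynomial.C S.euler_coeff_two
    have c1 := congrArg Polynomial.C S.euler_coeff_one
    have c0 := congrArg Polynomial.C S.euler_coeff_zero
    have hhC := congrArg Polynomial.C hh
    rw [hΘ, hη, hρ, eulerTerm, ← hhdef, X₁, X₂, X₀]
    simp only [map_mul, map_add, map_sub, map_neg, map_one, map_pow, map_ofNat] at c2 c1 c0 hhC ⊢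
    linear_combination Polynomial.C h * Polynomial.X ^ 2 * c2 +
      2 * Polynomial.C h * Polynomial.X * c1 + Polynomial.C h * c0 +
      ((Polynomial.C S.u + Polynomial.C S.v) * Polynomial.C S.i₀ *
        (Polynomial.C S.δ * Polynomial.X ^ 2 - 1) +
        (Polynomial.C S.u * Polynomial.C S.i₀ ^ 2 * Polynomial.C S.x +
          Polynomial.C S.v * Polynomial.C S.i₀ ^ 2 * Polynomial.C S.y) *
        Polynomial.C S.δ * Polynomial.X) * hhC
  have g1 := gauss_varDer S.δ_mul_μ S.integrand
  have g2 := gauss_varDer S.δ_mul_μ (C Polynomial.X * S.integrand)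
  -- Integration by parts for w times the integrand gives ⟨(δw² - 1)I⟩ = ⟨w dI/dw⟩.
  rw [coeffDer_mul, coeffDer_C, varDer_apply, Polynomial.derivative_X, map_one, mul_one,
    map_add] at g2
  have hG := congrArg (gauss S.μ) hE
  rw [hpoly, map_add, map_sub, mul_assoc X, mul_assoc X, gauss_X_mul, gauss_X_mul, gauss_X_mul,
    gauss_C_mul] at hG
  have hG' : gauss S.μ (C (Polynomial.C η * (Polynomial.C S.δ * Polynomial.X) +
      Polynomial.C ρ * (Polynomial.C S.δ * Polynomial.X ^ 2 - 1) + Polynomial.C S.eulerTerm) *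
      S.integrand) = C η * (C S.δ * gauss S.μ (C Polynomial.X * S.integrand)) +
      C ρ * (C S.δ * gauss S.μ (C Polynomial.X * (C Polynomial.X * S.integrand)) -
        gauss S.μ S.integrand) + C S.eulerTerm * gauss S.μ S.integrand := by
    rw [← gauss_C_mul, ← gauss_C_mul, ← gauss_C_mul, ← gauss_C_mul, ← map_sub, ← gauss_C_mul,
      ← map_add, ← map_add]
    congr 1
    simp only [map_mul, map_add, map_sub, map_one, map_pow]
    ring
  rw [hG'] at hG
  have e1 := polyDer_gauss D hDμ S.integrand
  have e2 := polyDer_gauss d hμ S.integrand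
  rw [map_zero, zero_mul, sub_zero] at e2
  have q : ∀ e : Derivation ℚ A A, coeffDer e (quadExp 0 (algebraMap ℚ A (-1 / 24))) = 0 := by
    intro e
    rw [coeffDer_quadExp, map_zero, Derivation.map_algebraMap]
    simp
  rw [rhs, coeffDer_mul, coeffDer_mul, q, q, e1, e2]
  linear_combination quadExp 0 (algebraMap ℚ A (-1 / 24)) * (hG - X * C η * g1 - X * C ρ * g2)

end Euler

end PentagonData
end PentagonEuler

/-! ### Base change, the limit of infinite shapes, and the ratio of both sides. -/

section PentagonFunctoriality

variable {A B : Type*} [CommRing A] [Algebra ℚ A] [CommRing B] [Algebra ℚ B]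

theorem li_eq_zero_of_add_sq {p : A} (hp : p + p ^ 2 = 0) (m : ℕ) : li p (m + 1) = 0 := by
  rw [li, polylogPoly, map_mul, map_add, map_pow, Polynomial.aeval_X, hp, zero_mul]

theorem psiP_zero (x : A) : psiP 0 x = 1 := by
  have h : psiE (0 : A) x = 0 := by
    ext n
    rw [psiE, coeff_mk, map_zero]
    split_ifs
    · rfl
    · rw [neg_eq_zero]
      refine Finset.sum_eq_zero fun q _ => ?_
      rcases q.1 + q.2 - 2 with _ | m
      · rw [li_zero, mul_zero]
      · rw [li_eq_zero_of_add_sq (by simp), mul_zero]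
  rw [psiP, h, formalExp_zero]

/-- This is z = ∞, where Li_{-m} vanishes for all m ≥ 1. Only pairs with k + ℓ = 2 and weight above
2 survive: (1, 1) and (2, 0). -/
theorem psiP_neg_one (x : A) : psiP (-1) x =
    quadExp (-(algebraMap ℚ A (1 / 2) * x)) (algebraMap ℚ A (1 / 12)) := by
  have hli : ∀ m, m ≠ 0 → li (-1 : A) m = 0 := by
    intro m hm
    obtain ⟨m, rfl⟩ := Nat.exists_eq_succ_of_ne_zero hm
    exact li_eq_zero_of_add_sq (by ring) m
  rw [psiP, quadExp]
  congr 1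
  ext n
  rw [psiE, coeff_mk, map_add, coeff_C_mul, coeff_C_mul, coeff_X, coeff_X_pow]
  rcases n with _ | _ | _ | n
  · simp
  · rw [if_neg (by omega), Finset.sum_eq_single (1, 1)]
    · rw [if_pos (by omega), if_neg (by omega)]
      change -(algebraMap ℚ A (bernoulli 1 / ((1 ! : ℚ) * (1 ! : ℚ))) * x ^ 1 * li (-1) 0) = _
      rw [li_zero, bernoulli_one, Nat.factorial_one, Nat.cast_one, mul_one, div_one, neg_div,
        map_neg]
      ring
    · rintro ⟨k, l⟩ hq hne
      rw [mem_weightPairs] at hq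
      simp only [ne_eq, Prod.mk.injEq] at hne hq
      rw [hli _ (by simp only; omega), mul_zero]
    · refine fun h => absurd (mem_weightPairs.mpr ?_) h
      simp only
  · rw [if_neg (by omega), Finset.sum_eq_single (2, 0)]
    · rw [if_neg (by omega), if_pos (by omega)]
      change -(algebraMap ℚ A (bernoulli 2 / ((0 ! : ℚ) * (2 ! : ℚ))) * x ^ 0 * li (-1) 0) = _
      rw [li_zero, bernoulli_two, Nat.factorial_zero, Nat.factorial_two,
        show (6⁻¹ / (((1 : ℕ) : ℚ) * ((2 : ℕ) : ℚ)) : ℚ) = 1 / 12 by norm_num]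
      ring
    · rintro ⟨k, l⟩ hq hne
      rw [mem_weightPairs] at hq
      simp only [ne_eq, Prod.mk.injEq] at hne hq
      rw [hli _ (by simp only; omega), mul_zero]
    · refine fun h => absurd (mem_weightPairs.mpr ?_) h
      simp only
  · rw [if_neg (by omega), if_neg (by omega), if_neg (by omega), mul_zero, mul_zero, add_zero,
      neg_eq_zero]
    refine Finset.sum_eq_zero ?_
    rintro ⟨k, l⟩ hq
    rw [mem_weightPairs] at hq
    simp only at hq
    rw [hli _ (by simp only; omega), mul_zero]

namespace PentagonData

variable (S : PentagonData A)

omit [Algebra ℚ A] [Algebra ℚ B] in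
/-- Base change of pentagon data. -/
def map (r : A →+* B) : PentagonData B where
  u := r S.u
  v := r S.v
  i₁ := r S.i₁
  i₂ := r S.i₂
  i₀ := r S.i₀
  x := r S.x
  y := r S.y
  hi₁ := by simpa only [map_mul, map_sub, map_one] using congrArg r S.hi₁
  hi₂ := by simpa only [map_mul, map_sub, map_one] using congrArg r S.hi₂
  hi₀ := by simpa only [map_mul, map_sub, map_one] using congrArg r S.hi₀

theorem map_lhs (r : A →+* B) : PowerSeries.map r S.lhs = (S.map r).lhs := by
  rw [lhs, map_mul, map_psiP, map_psiP, map_neg, map_neg]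
  rfl

theorem map_rhs (r : A →+* B) : PowerSeries.map r S.rhs = (S.map r).rhs := by
  have h₀ : r S.p₀ = (S.map r).p₀ := by simp only [p₀, map, map_neg, map_mul, map_sub, map_one]
  have h₁ : r S.p₁ = (S.map r).p₁ := by simp only [p₁, map, map_neg, map_mul]
  have h₂ : r S.p₂ = (S.map r).p₂ := by simp only [p₂, map, map_neg, map_mul]
  have hμ : r S.μ = (S.map r).μ := by simp only [μ, map, map_mul, map_sub, map_one, map_pow]
  have hs : r S.sh = (S.map r).sh := by simp only [sh, map, map_neg, map_mul, map_add]
  have hX₁ : Polynomial.mapRingHom r S.X₁ = (S.map r).X₁ := by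
    simp only [X₁, map_add, map_neg, Polynomial.coe_mapRingHom, Polynomial.map_X,
      Polynomial.map_C, ← hs]
    rfl
  have hX₂ : Polynomial.mapRingHom r S.X₂ = (S.map r).X₂ := by
    simp only [X₂, map_add, map_neg, Polynomial.coe_mapRingHom, Polynomial.map_X,
      Polynomial.map_C, ← hs]
    rfl
  have hX₀ : Polynomial.mapRingHom r S.X₀ = (S.map r).X₀ := by
    simp only [X₀, map_add, map_sub, Polynomial.coe_mapRingHom, Polynomial.map_X,
      Polynomial.map_C, ← hs]
    rfl
  rw [rhs, map_mul, map_quadExp, map_zero, RingHom.map_rat_algebraMap, map_gauss, integrand,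
    map_mul (PowerSeries.map _), map_mul (PowerSeries.map _), map_psiP, map_psiP, map_psiP, hX₁, hX₂, hX₀, Polynomial.coe_mapRingHom,
    Polynomial.map_C, Polynomial.map_C, Polynomial.map_C, h₀, h₁, h₂, hμ]
  rfl

/-- The pentagon identity in the limit of large shapes. -/
theorem rhs_eq_lhs_of_eq_zero (hu : S.u = 0) (hv : S.v = 0) : S.rhs = S.lhs := by
  have h1 : S.i₁ = 1 := by simpa [hu] using S.hi₁
  have h2 : S.i₂ = 1 := by simpa [hv] using S.hi₂
  have h0 : S.i₀ = 1 := by simpa [hu, hv] using S.hi₀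
  have hp₁ : S.p₁ = 0 := by simp [p₁, hv]
  have hp₂ : S.p₂ = 0 := by simp [p₂, hu]
  have hp₀ : S.p₀ = -1 := by simp [p₀, hu, hv, h1, h2]
  have hδ : S.δ = 1 := by simp [δ, hu, hv, h1, h2]
  have hsh : S.sh = 0 := by simp [sh, hu, hv]
  have hch : ∀ q : ℚ, algebraMap ℚ (Polynomial A) q = Polynomial.C (algebraMap ℚ A q) :=
    fun _ => rfl
  -- With δ = 1, translating the constant 1 by c = -1/2 evaluates ⟨e^{-wt/2}⟩ as e^{t²/8}. The
  -- t²-exponents then balance: -1/24 + 1/12 + 1/8 = 1/12 + 1/12.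
  have key := gauss_flow_varDer S.δ_mul_μ (-algebraMap ℚ A (1 / 2)) 1
  rw [map_one, gauss_one, one_mul, formalExp_gaussShift, hδ] at key
  have hI : S.integrand = PowerSeries.map Polynomial.C
      (quadExp (-algebraMap ℚ A (1 / 2) * (S.x + S.y)) (algebraMap ℚ A (1 / 12 + 1 / 8))) *
      quadExp (Polynomial.C (1 * -algebraMap ℚ A (1 / 2)) * Polynomial.X)
      (-Polynomial.C (algebraMap ℚ A (1 / 2) * (1 * (-algebraMap ℚ A (1 / 2)) ^ 2))) := by
    rw [integrand, hp₁, hp₂, hp₀, map_zero, psiP_zero, psiP_zero, one_mul, mul_one, map_neg,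
      map_one, psiP_neg_one, map_quadExp, ← quadExp_add, X₀, hsh, hch, hch]
    congr 1
    · simp only [map_mul, map_add, map_neg, map_sub, map_zero, map_one]
      ring
    · rw [← map_neg, ← map_add]
      congr 1
      rw [neg_sq, one_mul, ← map_pow, ← map_mul, ← map_neg, ← map_add]
      norm_num
  rw [rhs, hI, gauss_map_C_mul, ← key, mul_one, lhs, h1, h2, psiP_neg_one, psiP_neg_one,
    ← quadExp_add, ← quadExp_add, ← map_add, ← map_add]
  congr 1
  · ring
  · norm_num

theorem isUnit_lhs : IsUnit S.lhs := by
  refine IsUnit.of_mul_eq_one (formalExp (-psiE (-S.i₁) S.x) * formalExp (-psiE (-S.i₂) S.y)) ?_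
  rw [lhs, psiP, psiP, mul_mul_mul_comm, formalExp_mul_neg (constantCoeff_psiE _ _),
    formalExp_mul_neg (constantCoeff_psiE _ _), one_mul]

/-- The ratio of both sides is annihilated by the Euler derivation. -/
theorem exists_ratio {S : PentagonData A} (d D : Derivation ℚ A A) (hx : d S.x = 1)
    (hy : d S.y = 1) (hu : d S.u = 0) (hv : d S.v = 0) (hDx : D S.x = 0) (hDy : D S.y = 0)
    (hDu : D S.u = -S.u) (hDv : D S.v = -S.v) :
    ∃ g : PowerSeries A, S.rhs = g * S.lhs ∧ coeffDer D g = 0 := by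
  obtain ⟨b, hb⟩ := S.isUnit_lhs.exists_right_inv
  have hg : S.rhs = S.rhs * b * S.lhs := by linear_combination -S.rhs * hb
  refine ⟨S.rhs * b, hg, ?_⟩
  have hflow : flow d (S.rhs * b) = S.rhs * b := by
    have e1 := congrArg (flow d) hb
    rw [map_mul, map_one, S.flow_lhs d hx hy hu hv] at e1
    rw [map_mul, S.flow_rhs d hx hy hu hv]
    linear_combination (S.rhs * b) * e1 - S.multiplier * S.rhs * flow d b * hb
  generalize S.rhs * b = g at *
  have hd : coeffDer d g = 0 := coeffDer_eq_zero_of_flow_eq_self d hflow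
  have e2 := euler_rhs d D hx hy hu hv hDx hDy hDu hDv
  have e3 := euler_lhs d D hx hy hu hv hDx hDy hDu hDv
  rw [hg, coeffDer_mul, coeffDer_mul, hd] at e2
  -- Dividing one Euler equation by the other leaves t·Dg = dg, and dg = 0 by shift invariance.
  have e4 : X * coeffDer D g = 0 := by
    linear_combination b * e2 - b * g * e3 - X * coeffDer D g * hb
  ext n
  simpa using congrArg (coeff (n + 1)) e4

end PentagonData
end PentagonFunctoriality

/-! ### Formal shapes, and descent to arbitrary rings. -/

section PentagonUniversal

variable {R : Type*} [CommRing R] [Algebra ℚ R]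

omit [Algebra ℚ R] in
theorem coeff_X_mul_pderiv {σ : Type*} (i : σ) (f : MvPowerSeries σ R) (m : σ →₀ ℕ) :
    MvPowerSeries.coeff m (MvPowerSeries.X i * MvPowerSeries.pderiv R i f) =
      m i * MvPowerSeries.coeff m f := by
  classical
  by_cases hm : m i = 0
  · rw [hm, Nat.cast_zero, zero_mul, MvPowerSeries.X, MvPowerSeries.coeff_monomial_mul, if_neg]
    intro h
    simpa [hm] using h i
  · have h : m = Finsupp.single i 1 + (m - Finsupp.single i 1) := by
      rw [add_tsub_cancel_of_le]
      exact Finsupp.single_le_iff.mpr (Nat.one_le_iff_ne_zero.mpr hm)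
    generalize m - Finsupp.single i 1 = n at h
    rw [h, MvPowerSeries.X, MvPowerSeries.coeff_add_monomial_mul, one_mul,
      MvPowerSeries.coeff_pderiv, mul_comm, add_comm n]
    simp [add_comm]

/-- The negative of the Euler derivation in two variables. -/
def negEuler (R : Type*) [CommRing R] [Algebra ℚ R] :
    Derivation ℚ (MvPowerSeries (Fin 2) R) (MvPowerSeries (Fin 2) R) :=
  -((MvPowerSeries.X 0 : MvPowerSeries (Fin 2) R) •
      (MvPowerSeries.pderiv R (0 : Fin 2)).restrictScalars ℚ +
    (MvPowerSeries.X 1 : MvPowerSeries (Fin 2) R) •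
      (MvPowerSeries.pderiv R (1 : Fin 2)).restrictScalars ℚ)

theorem negEuler_apply (f : MvPowerSeries (Fin 2) R) :
    negEuler R f = -(MvPowerSeries.X 0 * MvPowerSeries.pderiv R 0 f +
      MvPowerSeries.X 1 * MvPowerSeries.pderiv R 1 f) := rfl

/-- The operator multiplies a monomial of total degree n by -n, which is invertible over ℚ unless n
= 0. -/
theorem eq_C_of_negEuler_eq_zero {f : MvPowerSeries (Fin 2) R} (h : negEuler R f = 0) :
    f = MvPowerSeries.C (MvPowerSeries.constantCoeff f) := by
  classical
  ext m
  rw [MvPowerSeries.coeff_C]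
  split_ifs with hm
  · rw [hm, MvPowerSeries.coeff_zero_eq_constantCoeff_apply]
  · have h1 := congrArg (MvPowerSeries.coeff m) h
    rw [negEuler_apply, map_neg, map_add, coeff_X_mul_pderiv, coeff_X_mul_pderiv,
      map_zero (MvPowerSeries.coeff m), ← add_mul, neg_eq_zero, ← Nat.cast_add] at h1
    obtain ⟨k, hk⟩ : ∃ k, m (0 : Fin 2) + m (1 : Fin 2) = k + 1 := by
      refine Nat.exists_eq_succ_of_ne_zero fun h0 => hm ?_
      ext i
      fin_cases i
      · exact (Nat.add_eq_zero_iff.mp h0).1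
      · exact (Nat.add_eq_zero_iff.mp h0).2
    rw [hk] at h1
    have h2 := congrArg (algebraMap ℚ R (1 / (k + 1)) * ·) h1
    simp only [mul_zero, ← mul_assoc] at h2
    rwa [← map_natCast (algebraMap ℚ R), ← map_mul, Nat.cast_add, Nat.cast_one,
      one_div_mul_cancel (by positivity), map_one, one_mul] at h2

namespace PentagonData

/-- The pentagon identity for formal shapes. -/
theorem rhs_eq_lhs_of_formal (S : PentagonData (MvPowerSeries (Fin 2) R)) {a b : R}
    (e : Derivation ℚ R R) (ha : e a = 1) (hb : e b = 1) (hu : S.u = MvPowerSeries.X 0)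
    (hv : S.v = MvPowerSeries.X 1) (hx : S.x = MvPowerSeries.C a) (hy : S.y = MvPowerSeries.C b) :
    S.rhs = S.lhs := by
  classical
  have hdC : ∀ r : R, mvCoeffDer (σ := Fin 2) e (MvPowerSeries.C r) = MvPowerSeries.C (e r) := by
    intro r
    ext m
    rw [coeff_mvCoeffDer, MvPowerSeries.coeff_C, MvPowerSeries.coeff_C]
    split_ifs
    · rfl
    · exact map_zero e
  have hdX : ∀ i : Fin 2, mvCoeffDer (σ := Fin 2) e (MvPowerSeries.X i) = 0 := by
    intro i
    ext m
    rw [coeff_mvCoeffDer, MvPowerSeries.coeff_X, map_zero]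
    split_ifs
    · exact Derivation.map_one_eq_zero e
    · exact map_zero e
  obtain ⟨g, hg, hDg⟩ := exists_ratio (S := S) (mvCoeffDer e) (negEuler R)
    (by rw [hx, hdC, ha, map_one]) (by rw [hy, hdC, hb, map_one]) (by rw [hu, hdX])
    (by rw [hv, hdX]) (by simp [hx, negEuler_apply]) (by simp [hy, negEuler_apply])
    (by simp [hu, negEuler_apply, MvPowerSeries.pderiv_X_of_ne])
    (by simp [hv, negEuler_apply, MvPowerSeries.pderiv_X_of_ne])
  have hgC : g = PowerSeries.map MvPowerSeries.C (PowerSeries.map MvPowerSeries.constantCoeff g) := by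
    ext1 n
    rw [coeff_map, coeff_map]
    exact eq_C_of_negEuler_eq_zero (by simpa using congrArg (coeff n) hDg)
  have h1 := congrArg (PowerSeries.map MvPowerSeries.constantCoeff) hg
  rw [map_mul, map_rhs, map_lhs, rhs_eq_lhs_of_eq_zero _ (by simp [map, hu]) (by simp [map, hv])] at h1
  have h2 : PowerSeries.map MvPowerSeries.constantCoeff g = 1 :=
    (isUnit_lhs _).mul_right_cancel (by rw [one_mul, ← h1])
  rw [hg, hgC, h2, map_one, one_mul]

omit [Algebra ℚ R] in
theorem exists_of_isUnit {u v x y : R}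
    (h : IsUnit ((1 - u) * (1 - v) * (1 - u - v))) :
    ∃ S : PentagonData R, S.u = u ∧ S.v = v ∧ S.x = x ∧ S.y = y := by
  obtain ⟨h12, h0⟩ := IsUnit.mul_iff.mp h
  obtain ⟨h1, h2⟩ := IsUnit.mul_iff.mp h12
  obtain ⟨i₁, hi₁⟩ := h1.exists_left_inv
  obtain ⟨i₂, hi₂⟩ := h2.exists_left_inv
  obtain ⟨i₀, hi₀⟩ := h0.exists_left_inv
  exact ⟨⟨u, v, i₁, i₂, i₀, x, y, hi₁, hi₂, hi₀⟩, rfl, rfl, rfl, rfl⟩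

/-- Pentagon data are determined by the shapes and the arguments. -/
@[ext]
theorem ext {A : Type*} [CommRing A] {S T : PentagonData A} (hu : S.u = T.u) (hv : S.v = T.v)
    (hx : S.x = T.x) (hy : S.y = T.y) : S = T := by
  have h : ∀ {a b c : A}, a * c = 1 → b * c = 1 → a = b := fun {a b c} ha hb => by
    linear_combination b * ha - a * hb
  have h1 : S.i₁ = T.i₁ := h S.hi₁ (hu ▸ T.hi₁)
  have h2 : S.i₂ = T.i₂ := h S.hi₂ (hv ▸ T.hi₂)
  have h0 : S.i₀ = T.i₀ := h S.hi₀ (by rw [hu, hv]; exact T.hi₀)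
  cases S
  cases T
  simp_all

/-- The pentagon identity over an arbitrary ring. -/
theorem rhs_eq_lhs (S : PentagonData R) : S.rhs = S.lhs := by
  -- The universal ring is ℚ[x, y][u, v] with this product inverted. Its constant term in u and v is
  -- 1, so it is also invertible among power series.
  let q : MvPolynomial (Fin 2) (MvPolynomial (Fin 2) ℚ) := (1 - MvPolynomial.X 0) * (1 - MvPolynomial.X 1) *
    (1 - MvPolynomial.X 0 - MvPolynomial.X 1)
  let L := Localization.Away q
  let j : MvPolynomial (Fin 2) (MvPolynomial (Fin 2) ℚ) →+* L := algebraMap _ _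
  have hq : IsUnit (j q) := IsLocalization.Away.algebraMap_isUnit q
  obtain ⟨T, hTu, hTv, hTx, hTy⟩ := exists_of_isUnit (R := L)
    (u := j (MvPolynomial.X 0)) (v := j (MvPolynomial.X 1))
    (x := j (MvPolynomial.C (MvPolynomial.X 0)))
    (y := j (MvPolynomial.C (MvPolynomial.X 1)))
    (by simpa only [j, q, map_mul, map_sub, map_one] using hq)
  have hT : T.rhs = T.lhs := by
    let c : MvPolynomial (Fin 2) (MvPolynomial (Fin 2) ℚ) →+*
        MvPowerSeries (Fin 2) (MvPolynomial (Fin 2) ℚ) :=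
      MvPolynomial.coeToMvPowerSeries.ringHom
    have hcX : ∀ i, c (MvPolynomial.X i) = MvPowerSeries.X i := MvPolynomial.coe_X
    have hcC : ∀ a, c (MvPolynomial.C a) = MvPowerSeries.C a := MvPolynomial.coe_C
    have hc : IsUnit (c q) := by
      rw [MvPowerSeries.isUnit_iff_constantCoeff]
      simp only [q, map_mul, map_sub, map_one, hcX, MvPowerSeries.constantCoeff_X, sub_zero,
        mul_one, isUnit_one]
    let ι : L →+* MvPowerSeries (Fin 2) (MvPolynomial (Fin 2) ℚ) := IsLocalization.Away.lift q hc
    have hι : ∀ p, ι (j p) = c p := IsLocalization.Away.lift_eq q hc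
    have hq0 : q ≠ 0 := by
      intro h
      rw [h, map_zero] at hc
      exact not_isUnit_zero hc
    -- Injectivity lets the identity over power series in u and v descend to the universal ring.
    have hinj : Function.Injective ι := by
      refine (IsLocalization.lift_injective_iff _).mpr fun a b => ?_
      rw [(IsLocalization.injective L (powers_le_nonZeroDivisors_of_noZeroDivisors hq0)).eq_iff]
      exact (MvPolynomial.coe_injective (Fin 2) (MvPolynomial (Fin 2) ℚ)).eq_iff.symm
    refine PowerSeries.map_injective ι hinj ?_
    rw [map_rhs, map_lhs]
    refine rhs_eq_lhs_of_formal _ (a := MvPolynomial.X 0) (b := MvPolynomial.X 1)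
      (MvPolynomial.pderiv 0 + MvPolynomial.pderiv 1 : Derivation ℚ (MvPolynomial (Fin 2) ℚ) _)
      ?_ ?_ ?_ ?_ ?_ ?_
    · simp [MvPolynomial.pderiv_X]
    · simp [MvPolynomial.pderiv_X]
    · rw [← hcX, ← hι, ← hTu, map]
    · rw [← hcX, ← hι, ← hTv, map]
    · rw [← hcC, ← hι, ← hTx, map]
    · rw [← hcC, ← hι, ← hTy, map]
  let s : MvPolynomial (Fin 2) (MvPolynomial (Fin 2) ℚ) →+* R := MvPolynomial.eval₂Hom
    (MvPolynomial.eval₂Hom (algebraMap ℚ R) ![S.x, S.y]) ![S.u, S.v]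
  have hs : IsUnit (s q) := by
    have h : s q = (1 - S.u) * (1 - S.v) * (1 - S.u - S.v) := by simp [s, q]
    rw [h]
    refine IsUnit.of_mul_eq_one (S.i₁ * S.i₂ * S.i₀) ?_
    linear_combination S.hi₁ + S.i₁ * (1 - S.u) * S.hi₂ +
      S.i₁ * (1 - S.u) * S.i₂ * (1 - S.v) * S.hi₀
  let r : L →+* R := IsLocalization.Away.lift q hs
  have hr : ∀ p, r (j p) = s p := IsLocalization.Away.lift_eq q hs
  have hS : T.map r = S := by
    refine PentagonData.ext ?_ ?_ ?_ ?_
    · simp [map, hTu, hr, s]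
    · simp [map, hTv, hr, s]
    · simp [map, hTx, hr, s]
    · simp [map, hTy, hr, s]
  rw [← hS, ← map_rhs, ← map_lhs, hT]

end PentagonData
end PentagonUniversal

/-! ### Specialization to the field ℚ(z₁, z₂). -/

section PentagonShapes

theorem z₁_ne_zero : z₁ ≠ 0 := algebraMap_ne_zero_of_eval _ (fun _ => 3) (by simp)

theorem z₂_ne_zero : z₂ ≠ 0 := algebraMap_ne_zero_of_eval _ (fun _ => 3) (by simp)

theorem one_sub_z₁_ne_zero : 1 - z₁ ≠ 0 := by
  have := algebraMap_ne_zero_of_eval (1 - MvPolynomial.X 0) (fun _ => 3) (by norm_num)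
  simpa [z₁] using this

theorem one_sub_z₂_ne_zero : 1 - z₂ ≠ 0 := by
  have := algebraMap_ne_zero_of_eval (1 - MvPolynomial.X 1) (fun _ => 3) (by norm_num)
  simpa [z₂] using this

theorem z₀_ne_zero : z₀ ≠ 0 := by
  have := algebraMap_ne_zero_of_eval
    (MvPolynomial.X 0 + MvPolynomial.X 1 - MvPolynomial.X 0 * MvPolynomial.X 1)
    (fun _ => 3) (by norm_num)
  simpa [z₀, z₁, z₂] using this

theorem one_sub_z₀ : 1 - z₀ = (1 - z₁) * (1 - z₂) := by
  simp only [z₀]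
  ring

theorem one_sub_z₁_div_z₀ : 1 - z₁ / z₀ = z₂ * (1 - z₁) / z₀ := by
  rw [eq_div_iff z₀_ne_zero, sub_mul, div_mul_cancel₀ _ z₀_ne_zero]
  simp only [z₀]
  ring

theorem one_sub_z₂_div_z₀ : 1 - z₂ / z₀ = z₁ * (1 - z₂) / z₀ := by
  rw [eq_div_iff z₀_ne_zero, sub_mul, div_mul_cancel₀ _ z₀_ne_zero]
  simp only [z₀]
  ring

theorem one_sub_inv_z₁ : 1 - z₁⁻¹ = -((1 - z₁) / z₁) := by
  have := z₁_ne_zero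
  field_simp
  ring

theorem one_sub_inv_z₂ : 1 - z₂⁻¹ = -((1 - z₂) / z₂) := by
  have := z₂_ne_zero
  field_simp
  ring

theorem one_sub_inv_z₁_sub_inv_z₂ : 1 - z₁⁻¹ - z₂⁻¹ = -(z₀ / (z₁ * z₂)) := by
  have := z₁_ne_zero
  have := z₂_ne_zero
  simp only [z₀]
  field_simp
  ring

/-- The pentagon data of the shapes `z₁` and `z₂` over the field of rational functions. -/
def shapeData : PentagonData ArgRing where
  u := MvPolynomial.C z₁⁻¹
  v := MvPolynomial.C z₂⁻¹
  i₁ := MvPolynomial.C (-(z₁ / (1 - z₁)))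
  i₂ := MvPolynomial.C (-(z₂ / (1 - z₂)))
  i₀ := MvPolynomial.C (-(z₁ * z₂ / z₀))
  x := varX
  y := varY
  hi₁ := by
    have := z₁_ne_zero
    have := one_sub_z₁_ne_zero
    rw [← map_one MvPolynomial.C, ← map_sub, ← map_mul, one_sub_inv_z₁]
    congr 1
    field_simp
  hi₂ := by
    have := z₂_ne_zero
    have := one_sub_z₂_ne_zero
    rw [← map_one MvPolynomial.C, ← map_sub, ← map_mul, one_sub_inv_z₂]
    congr 1
    field_simp
  hi₀ := by
    have := z₁_ne_zero
    have := z₂_ne_zero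
    have := z₀_ne_zero
    rw [← map_one MvPolynomial.C, ← map_sub, ← map_sub, ← map_mul, one_sub_inv_z₁_sub_inv_z₂]
    congr 1
    field_simp

theorem shapeData_p₀ : shapeData.p₀ = MvPolynomial.C (z₀ / (1 - z₀)) := by
  have := z₁_ne_zero
  have := z₂_ne_zero
  have := one_sub_z₁_ne_zero
  have := one_sub_z₂_ne_zero
  simp only [PentagonData.p₀, shapeData]
  rw [← map_one MvPolynomial.C, ← map_sub, ← map_sub, ← map_mul, ← map_mul, ← map_neg,
    one_sub_inv_z₁_sub_inv_z₂, one_sub_z₀]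
  congr 1
  field_simp

theorem shapeData_p₁ : shapeData.p₁ = MvPolynomial.C (z₁ / z₀ / (1 - z₁ / z₀)) := by
  have := z₂_ne_zero
  have := one_sub_z₁_ne_zero
  have := z₀_ne_zero
  simp only [PentagonData.p₁, shapeData]
  rw [← map_mul, ← map_neg, one_sub_z₁_div_z₀]
  congr 1
  field_simp

theorem shapeData_p₂ : shapeData.p₂ = MvPolynomial.C (z₂ / z₀ / (1 - z₂ / z₀)) := by
  have := z₁_ne_zero
  have := one_sub_z₂_ne_zero
  have := z₀_ne_zero
  simp only [PentagonData.p₂, shapeData]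
  rw [← map_mul, ← map_neg, one_sub_z₂_div_z₀]
  congr 1
  field_simp

theorem shapeData_sh : shapeData.sh = shift := by
  have := z₁_ne_zero
  have := z₂_ne_zero
  have := z₀_ne_zero
  simp only [PentagonData.sh, shapeData, shift]
  rw [← map_mul, ← map_mul, ← map_neg, ← map_neg,
    show -(z₁⁻¹ * -(z₁ * z₂ / z₀)) = z₂ / z₀ by field_simp,
    show -(z₂⁻¹ * -(z₁ * z₂ / z₀)) = z₁ / z₀ by field_simp]

theorem shapeData_μ : shapeData.μ = MvPolynomial.C pentagonForm⁻¹ := by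
  have := z₁_ne_zero
  have := z₂_ne_zero
  have := one_sub_z₁_ne_zero
  have := one_sub_z₂_ne_zero
  have := z₀_ne_zero
  simp only [PentagonData.μ, shapeData]
  rw [← map_one MvPolynomial.C, ← map_sub, ← map_sub, ← map_pow, ← map_mul, ← map_mul,
    one_sub_inv_z₁, one_sub_inv_z₂, pentagonForm_eq]
  congr 1
  field_simp

end PentagonShapes

end FormalPentagon

end

open FormalPentagon in
theorem theorem3p6 :
    psi varX z₁ * psi varY z₂ =
      expFactor *
        formalGauss pentagonForm
          (psi (-Polynomial.X + Polynomial.C (-varY + shift)) (z₁ / z₀) *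
            psi (Polynomial.X + Polynomial.C (varX + varY - shift)) z₀ *
            psi (-Polynomial.X + Polynomial.C (-varX + shift)) (z₂ / z₀)) := by
  have h : ∀ {z : ShapeField}, 1 - z ≠ 0 → z ≠ 1 := fun hz => (sub_ne_zero.mp hz).symm
  have n₀ : z₀ ≠ 1 := h (by
    rw [one_sub_z₀]
    exact mul_ne_zero one_sub_z₁_ne_zero one_sub_z₂_ne_zero)
  have n₁ : z₁ / z₀ ≠ 1 := h (by
    rw [one_sub_z₁_div_z₀]
    exact div_ne_zero (mul_ne_zero z₂_ne_zero one_sub_z₁_ne_zero) z₀_ne_zero)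
  have n₂ : z₂ / z₀ ≠ 1 := h (by
    rw [one_sub_z₂_div_z₀]
    exact div_ne_zero (mul_ne_zero z₁_ne_zero one_sub_z₂_ne_zero) z₀_ne_zero)
  have hl : psi varX z₁ * psi varY z₂ = shapeData.lhs := by
    rw [psi_eq_psiP (h one_sub_z₁_ne_zero), psi_eq_psiP (h one_sub_z₂_ne_zero), PentagonData.lhs]
    simp only [shapeData, ← map_neg, neg_neg]
    rfl
  have hr : expFactor = quadExp 0 (algebraMap ℚ ArgRing (-1 / 24)) := by
    rw [expFactor, quadExp, map_zero, zero_mul, zero_add]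
  rw [hl, ← shapeData.rhs_eq_lhs, PentagonData.rhs, PentagonData.integrand, hr, formalGauss_eq,
    psi_eq_psiP n₀, psi_eq_psiP n₁, psi_eq_psiP n₂, shapeData_p₀, shapeData_p₁, shapeData_p₂,
    shapeData_μ, ← shapeData_sh]
  rfl
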